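/- **Setting.** For $f:\mathbb Z\to\mathbb R$ put $\Delta f(j)=f(j+1)-f(j)$, $\Delta^k=\Delta(\Delta^{k-1})$, $\Delta^0 f=f$, and $f^{[k]}(j)=f(j)f(j+1)\cdots f(j+k-1)$, $f^{[0]}=1$. Let $X$ be an integer-valued random variable with finite mean $\mu$, probability mass function $p$ and support $S=\{j:p(j)>0\}$, and let $q(j)=\delta j^2+\beta j+\gamma$ be a real polynomial of degree at most two with $$\sum_{k\le j}(\mu-k)p(k)=q(j)p(j)\qquad\text{for all }j\in\mathbb Z ,$$ that is, $X\sim\mathrm{CO}(\mu;q)$. Put $M=|S|-1\in\{0,1,\dots\}\cup\{\infty\}$. Let $\mathcal C$ be the class of those $X$ that satisfy $X\sim\mathrm{CO}(\mu;\delta,\beta,\gamma)$ for some $(\mu;\delta,\beta,\gamma)$ and for which $\delta\le 0$ or $S$ is finite. For a probability mass function $p$ (of a random variable $X$) and a quadratic $q$ with leading coefficient $\delta$ let, for $j\in S$, $$P_k(j)=\frac{(-1)^k\Delta^k\big[q^{[k]}(j-k)p(j-k)\big]}{p(j)},\qquad c_k(\delta)=\prod_{j=k-1}^{2k-2}(1-j\delta),\qquad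 \phi_k=\frac{P_k}{\big(k!\,c_k(\delta)\,\mathbb E q^{[k]}(X)\big)^{1/2}} .$$ For $i\ge 0$ let $X_i$ have probability mass function $p_i(j)=q^{[i]}(j)p(j)/\mathbb E q^{[i]}(X)$, put $\delta_i=\delta/(1-2i\delta)$, $q_i(j)=q(j+i)/(1-2i\delta)$, and let $\phi_{k,i}$ be the polynomial $\phi_k$ formed with $(p_i,q_i,\delta_i)$ in place of $(p,q,\delta)$ (when $k=0$, $\phi_{0,i}=1$, whatever $q_i$ is). Finally, for $0\le i\le k$ let $$v^{(i)}_{k-i}=\bigg(\frac{k!\prod_{j=k-1}^{k+i-2}(1-j\delta)}{(k-i)!\;\mathbb E q^{[i]}(X)}\bigg)^{1/2}.$$ **Theorem.** Let $X\sim\mathrm{CO}(\mu;q)$ and let $g$ be a real function on $\mathbb Z$ (only its values on $S$ matter). (a) Let $k$ be an integer with $1\le k\le M$ and $\mathbb E|X|^{2k+1}<\infty$. Then $p_0,\dots,p_k$ are probability mass functions. If moreover $0\le m\le k$ and $\Delta^m g\in L^2(X_m)$ (for instance $m=k$), then $\phi_k(X)g(X)$ is integrable and, for all $i=0,1,\dots,m$,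 $\phi_{k-i,i}(X_i)\Delta^i g(X_i)$ is integrable and $$\mathbb E\,\phi_{k-i,i}(X_i)\,\Delta^i g(X_i)=v^{(i)}_{k-i}\;\mathbb E\,\phi_k(X)g(X).$$ (b) Let $X\in\mathcal C$ and let $n$ be an integer with $1\le n\le M$ and $\Delta^n g\in L^2(X_n)$. Then the Fourier coefficients $\alpha_k=\mathbb E\,\phi_k(X)g(X)$ exist for all integers $0\le k\le M$, and for all $i=0,1,\dots,n$ the expectation below is finite, the series (over integers $k$ with $i\le k\le M$) converges, and $$\mathbb E\,q^{[i]}(X)\big(\Delta^i g(X)\big)^2=\sum_{k=i}^{M}\frac{k!\prod_{j=k-1}^{k+i-2}(1-j\delta)}{(k-i)!}\,\alpha_k^2 .$$ -/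

import Mathlib

open MeasureTheory

noncomputable section

namespace CumOrd

/-- The quadratic `q(j) = δ j² + β j + γ` (any of the coefficients may vanish) on the integers. -/
def quad (δ β γ : ℝ) (j : ℤ) : ℝ := δ * (j : ℝ) ^ 2 + β * (j : ℝ) + γ

/-- The ascending power `f^{[k]}(x) = f(x) f(x+1) ⋯ f(x+k-1)`, with `f^{[0]} = 1`. -/
def ascPow (f : ℤ → ℝ) (k : ℕ) (x : ℤ) : ℝ := ∏ r ∈ Finset.range k, f (x + (r : ℤ))

/-- The `k`-th iterate of the forward difference operator `Δ f(j) = f(j+1) - f(j)`. -/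
def diff (k : ℕ) (f : ℤ → ℝ) : ℤ → ℝ := (fwdDiff (1 : ℤ))^[k] f

/-- The probability mass function `p(j) = Pr(X = j)` of an integer-valued random variable. -/
def pmfOf {Ω : Type*} [MeasurableSpace Ω] (P : Measure Ω) (X : Ω → ℤ) (j : ℤ) : ℝ :=
  P.real (X ⁻¹' {j})

/-- The support `S = {j : Pr(X = j) > 0}`. -/
def support {Ω : Type*} [MeasurableSpace Ω] (P : Measure Ω) (X : Ω → ℤ) : Set ℤ :=
  {j | 0 < pmfOf P X j}

/-- `M(X) = |S(X)| - 1`, possibly infinite. -/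
def bigM {Ω : Type*} [MeasurableSpace Ω] (P : Measure Ω) (X : Ω → ℤ) : ℕ∞ :=
  (support P X).encard - 1

/-- `X ∼ CO(μ; δ, β, γ)`: the integer-valued random variable `X` has finite mean `μ`, and
`∑_{k ≤ j} (μ - k) p(k) = q(j) p(j)` for all integers `j`, where `q(j) = δ j² + β j + γ`. -/
structure IsCO {Ω : Type*} [MeasurableSpace Ω] (P : Measure Ω) (X : Ω → ℤ)
    (μ δ β γ : ℝ) : Prop where
  measurable : Measurable X
  integrable : Integrable (fun ω => (X ω : ℝ)) P
  mean_eq : ∫ ω, (X ω : ℝ) ∂P = μ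
  cumulative : ∀ j : ℤ,
    ∑' k : Set.Iic j, (μ - ((k : ℤ) : ℝ)) * pmfOf P X (k : ℤ) = quad δ β γ j * pmfOf P X j

/-- The class `𝒞` of the cumulative Ord random variables with `δ ≤ 0` or finite support. -/
def InClassC {Ω : Type*} [MeasurableSpace Ω] (P : Measure Ω) (X : Ω → ℤ) : Prop :=
  ∃ μ δ β γ : ℝ, IsCO P X μ δ β γ ∧ (δ ≤ 0 ∨ (support P X).Finite)

/-- `p` is a probability mass function on the integers. -/
def IsPmf (p : ℤ → ℝ) : Prop := (∀ j, 0 ≤ p j) ∧ HasSum p 1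

/-- The law on the integers whose probability mass function is `p`. -/
def lawOf (p : ℤ → ℝ) : Measure ℤ :=
  Measure.count.withDensity (fun j => ENNReal.ofReal (p j))

/-- `A_k = E q^{[k]}(X)`, where `X` has probability mass function `p`. -/
def momentA (p q : ℤ → ℝ) (k : ℕ) : ℝ := ∫ j, ascPow q k j ∂(lawOf p)

/-- `c_k(δ) = ∏_{j=k-1}^{2k-2} (1 - j δ)`. -/
def leadC (k : ℕ) (δ : ℝ) : ℝ :=
  ∏ r ∈ Finset.range k, (1 - ((k : ℝ) - 1 + (r : ℝ)) * δ)

/-- The Rodrigues-type function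
`P_k(j) = (-1)^k Δ^k [q^{[k]}(j-k) p(j-k)] / p(j)` on the support of `p`. -/
def rodrigues (p q : ℤ → ℝ) (k : ℕ) (j : ℤ) : ℝ :=
  (-1) ^ k * diff k (fun t => ascPow q k (t - (k : ℤ)) * p (t - (k : ℤ))) j / p j

/-- The standardized polynomial `φ_k = P_k / (k! c_k(δ) E q^{[k]}(X))^{1/2}`, for a probability
mass function `p` and a quadratic `q` with leading coefficient `δ`. -/
def stdPoly (p q : ℤ → ℝ) (δ : ℝ) (k : ℕ) (j : ℤ) : ℝ :=
  rodrigues p q k j / Real.sqrt ((k.factorial : ℝ) * leadC k δ * momentA p q k)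

/-- `p_i(j) = q^{[i]}(j) p(j) / E q^{[i]}(X)`. -/
def pmfI (p q : ℤ → ℝ) (i : ℕ) (j : ℤ) : ℝ := ascPow q i j * p j / momentA p q i

/-- `q_i(j) = q(j+i) / (1 - 2iδ)`, for a quadratic `q` with leading coefficient `δ`. -/
def quadI (q : ℤ → ℝ) (δ : ℝ) (i : ℕ) (j : ℤ) : ℝ := q (j + (i : ℤ)) / (1 - 2 * (i : ℝ) * δ)

/-- The leading coefficient `δ_i = δ / (1 - 2iδ)` of `q_i`. -/
def deltaI (δ : ℝ) (i : ℕ) : ℝ := δ / (1 - 2 * (i : ℝ) * δ)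

/-- `φ_{k,i}`, the standardized polynomial of degree `k` that belongs to `(p_i, q_i)`. -/
def stdPolyI (p q : ℤ → ℝ) (δ : ℝ) (k i : ℕ) : ℤ → ℝ :=
  stdPoly (pmfI p q i) (quadI q δ i) (deltaI δ i) k

/-- `k! ∏_{j=k-1}^{k+i-2} (1 - j δ) / (k-i)!`, used for `i ≤ k`. -/
def weight (δ : ℝ) (k i : ℕ) : ℝ :=
  (k.factorial : ℝ) * (∏ r ∈ Finset.range i, (1 - ((k : ℝ) - 1 + (r : ℝ)) * δ)) /
    ((k - i).factorial : ℝ)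

/-- `v^{(i)}_{k-i} = (k! ∏_{j=k-1}^{k+i-2} (1 - j δ) / ((k-i)! E q^{[i]}(X)))^{1/2}`, for `i ≤ k`. -/
def coeffV (p q : ℤ → ℝ) (δ : ℝ) (k i : ℕ) : ℝ := Real.sqrt (weight δ k i / momentA p q i)

end CumOrd

end

/-! Write `w_i = q^{[i]} p`. Differencing the cumulative identity gives `q(j)p(j) - q(j-1)p(j-1) =
(μ - j)p(j)`, and so the backward difference of `w_{i+1}` is an affine function times `w_i`.
Iterating, the `t`-fold negated backward difference of `w_{i+t}` is a polynomial of degree at most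
`t`, with explicit leading coefficient, times `w_i` (`exists_backDiff_wt`). Up to a constant this
product is `φ_{t,i} p_i`.

Part (a) is therefore summation by parts: in the sum of `g` against the `k`-fold difference of
`w_k`, differences are moved one at a time from the weight to `g`. The delicate point is that
integrability is known only for `Δ^m g` and has to be passed down to `g`. In `summation_by_parts`
the weight has constant sign near `±∞`, being a polynomial times a nonnegative sequence, so its
absolute tails are the absolute values of its tails up to finitely many exceptions, and Tonelli's
theorem applies.

For part (b), membership in `𝒞` gives exponential tails: trivially for finite support, and for `δ ≤
0` by geometric decay of `q p`. A Hardy type inequality (`summable_sq_of_fwdDiff`) brings square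
summability from `Δ^n g` down to every `Δ^i g` with respect to `w_i`. The polynomials attached to
`w_i` are orthogonal, again by summation by parts. They are complete, because a sequence with
exponential decay and vanishing moments is zero; if the polynomials stop at a finite degree,
interpolation on the finite support replaces this argument. Parseval's identity for `Δ^i g`, with
its Fourier coefficients rewritten by (a), is the claim. -/

namespace CumOrd

/-! ### Polynomials on the integers with a prescribed top coefficient -/

open Polynomial in
/-- `f` is the restriction to `ℤ` of a real polynomial of degree at most `n` whose coefficient of
degree `n` is `c`. -/
def HasLead (n : ℕ) (c : ℝ) (f : ℤ → ℝ) : Prop :=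
  ∃ P : ℝ[X], P.natDegree ≤ n ∧ P.coeff n = c ∧ ∀ j, f j = P.eval (j : ℝ)

namespace HasLead

open Polynomial

variable {n m : ℕ} {c d : ℝ} {f g : ℤ → ℝ}

theorem const (c : ℝ) : HasLead 0 c (fun _ => c) :=
  ⟨C c, by simp, by simp, by simp⟩

theorem cast : HasLead 1 1 (fun j => (j : ℝ)) :=
  ⟨X, by simp, by simp, by simp⟩

theorem add (hf : HasLead n c f) (hg : HasLead n d g) : HasLead n (c + d) (fun j => f j + g j) := by
  obtain ⟨P, hP, rfl, hPf⟩ := hf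
  obtain ⟨Q, hQ, rfl, hQg⟩ := hg
  exact ⟨P + Q, natDegree_add_le_of_degree_le hP hQ, by simp, fun j => by simp [hPf, hQg]⟩

theorem mul (hf : HasLead n c f) (hg : HasLead m d g) :
    HasLead (n + m) (c * d) (fun j => f j * g j) := by
  obtain ⟨P, hP, rfl, hPf⟩ := hf
  obtain ⟨Q, hQ, rfl, hQg⟩ := hg
  exact ⟨P * Q, natDegree_mul_le_of_le hP hQ, coeff_mul_add_eq_of_natDegree_le hP hQ,
    fun j => by simp [hPf, hQg]⟩

theorem const_mul (hf : HasLead n c f) (a : ℝ) : HasLead n (a * c) (fun j => a * f j) := by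
  simpa using (const a).mul hf

theorem neg (hf : HasLead n c f) : HasLead n (-c) (fun j => -f j) := by
  simpa using hf.const_mul (-1)

theorem sub (hf : HasLead n c f) (hg : HasLead n d g) :
    HasLead n (c - d) (fun j => f j - g j) := by
  simpa [sub_eq_add_neg] using hf.add hg.neg

theorem of_lt (hf : HasLead n c f) (h : n < m) : HasLead m 0 f := by
  obtain ⟨P, hP, rfl, hPf⟩ := hf
  exact ⟨P, hP.trans h.le, coeff_eq_zero_of_natDegree_lt (hP.trans_lt h), hPf⟩

theorem shift (hf : HasLead n c f) (s : ℤ) : HasLead n c (fun j => f (j + s)) := by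
  obtain ⟨P, hP, rfl, hPf⟩ := hf
  refine ⟨taylor (s : ℝ) P, by simpa using hP, ?_, fun j => by simp [hPf, taylor_eval]⟩
  -- The `n`-th Taylor coefficient is the value of the `n`-th Hasse derivative, which is constant
  -- since `P` has degree at most `n`.
  rw [taylor_coeff, eval_eq_sum_range' (n := 1)]
  · simp [hasseDeriv_coeff]
  · have := natDegree_hasseDeriv_le P n
    omega

/-- Differencing lowers the degree and multiplies the leading coefficient by the degree. -/
theorem diff_shift (hf : HasLead (n + 1) c f) (s : ℤ) :
    HasLead n ((n + 1) * c * s) (fun j => f (j + s) - f j) := by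
  obtain ⟨P, hP, rfl, hPf⟩ := hf
  have hco : ∀ k, n ≤ k → (taylor (s : ℝ) P - P).coeff k
      = if k = n then ((n : ℝ) + 1) * P.coeff (n + 1) * s else 0 := by
    intro k hk
    -- For `k ≥ n` the `k`-th Hasse derivative has degree at most one: its constant term cancels
    -- against `P`, and its linear term is the claimed coefficient.
    rw [coeff_sub, taylor_coeff, eval_eq_sum_range' (n := 2)]
    · rw [Finset.sum_range_succ, Finset.sum_range_one]
      simp only [hasseDeriv_coeff]
      split_ifs with h
      · subst h
        simp [add_comm 1]
      · have : P.coeff (1 + k) = 0 := coeff_eq_zero_of_natDegree_lt (by omega)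
        simp [this]
    · have := natDegree_hasseDeriv_le P k
      omega
  refine ⟨taylor (s : ℝ) P - P, ?_, by simpa using hco n le_rfl,
    fun j => by simp [hPf, taylor_eval]⟩
  refine natDegree_le_iff_coeff_eq_zero.2 fun k hk => ?_
  simpa [hk.ne'] using hco k hk.le

theorem fwdDiff_iter (hf : HasLead n c f) (j : ℤ) : diff n f j = n.factorial * c := by
  induction n generalizing c f with
  | zero =>
    obtain ⟨P, hP, rfl, hPf⟩ := hf
    rw [eq_C_of_natDegree_le_zero hP] at hPf
    simp [diff, hPf]
  | succ n ih =>
    have := ih (hf.diff_shift 1)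
    simp only [diff, Function.iterate_succ, Function.comp_apply] at this ⊢
    rw [Nat.factorial_succ]
    push_cast at this ⊢
    rw [show fwdDiff (1 : ℤ) f = fun j => f (j + 1) - f j from rfl, this]
    ring

theorem exists_bound (hf : HasLead n c f) : ∃ K, 0 ≤ K ∧ ∀ j, |f j| ≤ K * (1 + |(j : ℝ)|) ^ n := by
  obtain ⟨P, hP, rfl, hPf⟩ := hf
  refine ⟨∑ i ∈ Finset.range (n + 1), |P.coeff i|, Finset.sum_nonneg fun _ _ => abs_nonneg _,
    fun j => ?_⟩
  rw [hPf, eval_eq_sum_range' (n := n + 1) (by omega), Finset.sum_mul]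
  refine (Finset.abs_sum_le_sum_abs _ _).trans (Finset.sum_le_sum fun i hi => ?_)
  rw [abs_mul, abs_pow]
  have hi' : i ≤ n := by simpa [Nat.lt_succ_iff] using hi
  gcongr
  calc |(j : ℝ)| ^ i ≤ (1 + |(j : ℝ)|) ^ i := by gcongr; linarith
    _ ≤ _ := pow_le_pow_right₀ (by linarith [abs_nonneg (j : ℝ)]) hi'

/-- Source of the constant signs near `±∞` on which summation by parts relies. -/
theorem _root_.Polynomial.eventually_sign_atTop (P : ℝ[X]) :
    (∀ᶠ x in Filter.atTop, 0 ≤ P.eval x) ∨ (∀ᶠ x in Filter.atTop, P.eval x ≤ 0) := by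
  by_cases hd : 0 < P.degree
  · rcases le_total 0 P.leadingCoeff with h | h
    · exact .inl ((P.tendsto_atTop_of_leadingCoeff_nonneg hd h).eventually_ge_atTop 0)
    · exact .inr ((P.tendsto_atBot_of_leadingCoeff_nonpos hd h).eventually_le_atBot 0)
  · rw [eq_C_of_degree_le_zero (not_lt.1 hd)]
    rcases le_total 0 (P.coeff 0) with h | h
    · exact .inl (by simp [h])
    · exact .inr (by simp [h])

theorem eventually_sign_atTop (hf : HasLead n c f) :
    (∀ᶠ j in Filter.atTop, 0 ≤ f j) ∨ (∀ᶠ j in Filter.atTop, f j ≤ 0) := by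
  obtain ⟨P, -, -, hPf⟩ := hf
  simp only [hPf]
  exact P.eventually_sign_atTop.imp (fun h => tendsto_intCast_atTop_atTop.eventually h)
    (fun h => tendsto_intCast_atTop_atTop.eventually h)

theorem eventually_sign_atBot (hf : HasLead n c f) :
    (∀ᶠ j in Filter.atBot, 0 ≤ f j) ∨ (∀ᶠ j in Filter.atBot, f j ≤ 0) := by
  obtain ⟨P, -, -, hPf⟩ := hf
  have key : Filter.Tendsto (fun j : ℤ => -(j : ℝ)) Filter.atBot Filter.atTop :=
    Filter.tendsto_neg_atBot_atTop.comp (tendsto_intCast_atBot_iff.2 Filter.tendsto_id)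
  have h2 : ∀ j : ℤ, (P.comp (-X)).eval (-(j : ℝ)) = f j := by simp [hPf]
  refine (P.comp (-X)).eventually_sign_atTop.imp (fun h => ?_) (fun h => ?_)
  · simpa only [h2] using key.eventually h
  · simpa only [h2] using key.eventually h

theorem congr (hf : HasLead n c f) (hfg : ∀ j, g j = f j) (hc : d = c) : HasLead n d g := by
  obtain rfl : g = f := funext hfg
  exact hc ▸ hf

end HasLead

end CumOrd

/-! ### Summation by parts and a Hardy inequality on the integers -/

namespace CumOrd

/-- The kernel with `∑ y, stepKer x y * (h (y + 1) - h y) = h x - h 0`. -/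
def stepKer (x y : ℤ) : ℝ := if 0 ≤ y ∧ y < x then 1 else if x ≤ y ∧ y < 0 then -1 else 0

theorem stepKer_succ (x y : ℤ) : stepKer (x + 1) y = stepKer x y + if y = x then 1 else 0 := by
  unfold stepKer
  split_ifs <;> first | omega | norm_num

theorem hasSum_stepKer (h : ℤ → ℝ) (x : ℤ) :
    HasSum (fun y => stepKer x y * (h (y + 1) - h y)) (h x - h 0) := by
  have hone (x : ℤ) : HasSum (fun y => (if y = x then (1 : ℝ) else 0) * (h (y + 1) - h y))
      (h (x + 1) - h x) := by
    simpa using hasSum_ite_eq x (h (x + 1) - h x) |>.congr_fun (g := fun y =>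
      (if y = x then (1 : ℝ) else 0) * (h (y + 1) - h y)) (fun y => by split_ifs with e <;> simp [e])
  induction x using Int.induction_on with
  | zero =>
    convert hasSum_zero (α := ℝ) (β := ℤ) using 1
    · funext y
      have : stepKer 0 y = 0 := by unfold stepKer; split_ifs <;> first | omega | rfl
      simp [this]
    · simp
  | succ n ih =>
    have := ih.add (hone n)
    simp only [← add_mul, ← stepKer_succ] at this
    convert this using 1
    ring
  | pred n ih =>
    have := ih.sub (hone (-n - 1))
    have e (y : ℤ) : stepKer (-n - 1) y = stepKer (-n) y - if y = -n - 1 then 1 else 0 := by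
      have := stepKer_succ (-n - 1) y
      rw [sub_add_cancel] at this
      linarith
    simp only [← sub_mul, ← e] at this
    rw [sub_add_cancel] at this
    simpa using this

/-- Cauchy–Schwarz: there are at most `|x|` unit steps between `0` and `x`. -/
theorem sq_sub_le_stepKer (h : ℤ → ℝ) (x : ℤ) :
    (h x - h 0) ^ 2 ≤ |(x : ℝ)| * ∑' y, |stepKer x y| * (h (y + 1) - h y) ^ 2 := by
  set A : Finset ℤ := Finset.Ico 0 x ∪ Finset.Ico x 0 with hA
  have hcard : (A.card : ℝ) ≤ |(x : ℝ)| := by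
    have h1 : A.card ≤ x.natAbs := by
      refine (Finset.card_union_le _ _).trans ?_
      simp only [Int.card_Ico]
      omega
    calc (A.card : ℝ) ≤ (x.natAbs : ℝ) := by exact_mod_cast h1
      _ = |(x : ℝ)| := by rw [Nat.cast_natAbs]; simp
  have h0 : ∀ y, y ∉ A → stepKer x y = 0 := by
    intro y hy
    simp only [hA, Finset.mem_union, Finset.mem_Ico] at hy
    unfold stepKer
    split_ifs <;> first | omega | rfl
  have h1 : ∀ y, stepKer x y ^ 2 ≤ |stepKer x y| := by
    intro y
    unfold stepKer
    split_ifs <;> norm_num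
  rw [← (hasSum_stepKer h x).tsum_eq, tsum_eq_sum (s := A) (fun y hy => by simp [h0 y hy]),
    tsum_eq_sum (s := A) (fun y hy => by simp [h0 y hy])]
  refine (sq_sum_le_card_mul_sum_sq).trans ?_
  gcongr with y
  rw [mul_pow]
  exact mul_le_mul_of_nonneg_right (h1 y) (sq_nonneg _)

section Tails

variable {B C : ℤ → ℝ} (hBC : ∀ j, B j = C (j - 1) - C j) (hB : Summable B)
  (htop : Filter.Tendsto C Filter.atTop (nhds 0)) (hbot : Filter.Tendsto C Filter.atBot (nhds 0))

include hBC hB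

include htop in
theorem hasSum_indicator_Ioi (y : ℤ) : HasSum ((Set.Ioi y).indicator B) (C y) := by
  have hinj : Function.Injective (fun n : ℕ => y + 1 + (n : ℤ)) := fun a b hab => by
    simpa using hab
  rw [← hinj.hasSum_iff]
  · have hs : Summable ((Set.Ioi y).indicator B ∘ fun n : ℕ => y + 1 + (n : ℤ)) :=
      (hB.indicator _).comp_injective hinj
    rw [hs.hasSum_iff_tendsto_nat]
    have e : ∀ n : ℕ, ∑ i ∈ Finset.range n,
        ((Set.Ioi y).indicator B ∘ fun n : ℕ => y + 1 + (n : ℤ)) i = C y - C (y + n) := by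
      intro n
      induction n with
      | zero => simp
      | succ n ih =>
        rw [Finset.sum_range_succ, ih]
        have : y < y + 1 + (n : ℤ) := by omega
        simp only [Function.comp_apply, Set.indicator, Set.mem_Ioi, this, if_true, hBC]
        rw [show y + 1 + (n : ℤ) - 1 = y + n by ring, show y + 1 + (n : ℤ) = y + (n + 1 : ℕ) by
          push_cast; ring]
        ring
    simp only [e]
    have : Filter.Tendsto (fun n : ℕ => C (y + n)) Filter.atTop (nhds 0) :=
      htop.comp (Filter.tendsto_atTop_add_const_left _ _ tendsto_natCast_atTop_atTop)
    simpa using this.const_sub (C y)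
  · intro x hx
    refine Set.indicator_of_notMem (fun h => hx ⟨(x - y - 1).toNat, ?_⟩) _
    have : y < x := h
    simp only
    omega

include hbot in
theorem hasSum_indicator_Iic (y : ℤ) : HasSum ((Set.Iic y).indicator B) (-C y) := by
  have hinj : Function.Injective (fun n : ℕ => y - (n : ℤ)) := fun a b hab => by
    simpa using hab
  rw [← hinj.hasSum_iff]
  · have hs : Summable ((Set.Iic y).indicator B ∘ fun n : ℕ => y - (n : ℤ)) :=
      (hB.indicator _).comp_injective hinj
    rw [hs.hasSum_iff_tendsto_nat]
    have e : ∀ n : ℕ, ∑ i ∈ Finset.range n,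
        ((Set.Iic y).indicator B ∘ fun n : ℕ => y - (n : ℤ)) i = C (y - n) - C y := by
      intro n
      induction n with
      | zero => simp
      | succ n ih =>
        rw [Finset.sum_range_succ, ih]
        have : y - (n : ℤ) ≤ y := by omega
        simp only [Function.comp_apply, Set.indicator, Set.mem_Iic, this, if_true, hBC]
        rw [show y - (n : ℤ) - 1 = y - (n + 1 : ℕ) by push_cast; ring]
        ring
    simp only [e]
    have : Filter.Tendsto (fun n : ℕ => C (y - n)) Filter.atTop (nhds 0) := by
      refine hbot.comp ?_
      simp only [sub_eq_add_neg]
      exact Filter.tendsto_atBot_add_const_left _ _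
        (Filter.tendsto_neg_atTop_atBot.comp tendsto_natCast_atTop_atTop)
    simpa using this.sub_const (C y)
  · intro x hx
    refine Set.indicator_of_notMem (fun h => hx ⟨(y - x).toNat, ?_⟩) _
    have : x ≤ y := h
    simp only
    omega

include htop hbot in
theorem hasSum_telescope : HasSum B 0 := by
  have := (hasSum_indicator_Iic hBC hB hbot 0).add (hasSum_indicator_Ioi hBC hB htop 0)
  rw [neg_add_cancel] at this
  convert this using 1
  funext x
  by_cases hx : x ≤ 0 <;> simp [Set.indicator, hx]

-- For `y ≥ 0` the column `stepKer · y` is the indicator of `(y, ∞)`, for `y < 0` minus the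
-- indicator of `(-∞, y]`; both tails of `B` telescope to `C y`.
include htop hbot in
theorem hasSum_mul_stepKer (y : ℤ) : HasSum (fun x => B x * stepKer x y) (C y) := by
  rcases le_or_gt 0 y with hy | hy
  · convert hasSum_indicator_Ioi hBC hB htop y using 1
    funext x
    simp only [stepKer, Set.indicator, Set.mem_Ioi]
    split_ifs <;> first | omega | simp
  · have := (hasSum_indicator_Iic hBC hB hbot y).neg
    rw [neg_neg] at this
    refine this.congr_fun fun x => ?_
    simp only [stepKer, Set.indicator, Set.mem_Iic]
    split_ifs <;> first | omega | simp

include htop hbot in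
/-- If `B` has constant signs near `±∞`, then its absolute tails are the absolute values of its
tails, up to finitely many exceptions. -/
theorem eventually_tsum_abs_mul_stepKer
    (st : (∀ᶠ j in Filter.atTop, 0 ≤ B j) ∨ (∀ᶠ j in Filter.atTop, B j ≤ 0))
    (sb : (∀ᶠ j in Filter.atBot, 0 ≤ B j) ∨ (∀ᶠ j in Filter.atBot, B j ≤ 0)) :
    ∀ᶠ y in Filter.cofinite, ∑' x, |B x| * |stepKer x y| = |C y| := by
  have key : ∀ y, (∀ x, stepKer x y ≠ 0 → 0 ≤ B x * stepKer x y) →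
      ∑' x, |B x| * |stepKer x y| = |C y| := by
    intro y h
    have h0 : ∀ x, |B x| * |stepKer x y| = B x * stepKer x y := by
      intro x
      rw [← abs_mul, abs_of_nonneg]
      by_cases hx : stepKer x y = 0
      · simp [hx]
      · exact h x hx
    have hs := hasSum_mul_stepKer hBC hB htop hbot y
    have : 0 ≤ C y := hs.nonneg fun x => by rw [← h0 x]; positivity
    rw [abs_of_nonneg this, ← hs.tsum_eq]
    exact tsum_congr h0
  have key' : ∀ y, (∀ x, stepKer x y ≠ 0 → B x * stepKer x y ≤ 0) →
      ∑' x, |B x| * |stepKer x y| = |C y| := by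
    intro y h
    have h0 : ∀ x, |B x| * |stepKer x y| = -(B x * stepKer x y) := by
      intro x
      rw [← abs_mul, abs_of_nonpos]
      by_cases hx : stepKer x y = 0
      · simp [hx]
      · exact h x hx
    have hs := hasSum_mul_stepKer hBC hB htop hbot y
    have : 0 ≤ -C y := hs.neg.nonneg fun x => by rw [← h0 x]; positivity
    rw [abs_of_nonpos (by linarith), ← hs.tsum_eq, ← tsum_neg]
    exact tsum_congr h0
  rw [Int.cofinite_eq, Filter.eventually_sup]
  constructor
  · have hk : ∀ x y, y < 0 → stepKer x y ≠ 0 → stepKer x y = -1 ∧ x ≤ y := by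
      intro x y hy
      unfold stepKer
      split_ifs <;> first | omega | simp_all
    rcases sb with h | h <;> obtain ⟨N, hN⟩ := Filter.eventually_atBot.1 h
    · filter_upwards [Filter.eventually_lt_atBot 0, Filter.eventually_le_atBot N] with y hy0 hyN
      refine key' y fun x hx => ?_
      obtain ⟨h1, h2⟩ := hk x y hy0 hx
      have := hN x (h2.trans hyN)
      rw [h1]; linarith
    · filter_upwards [Filter.eventually_lt_atBot 0, Filter.eventually_le_atBot N] with y hy0 hyN
      refine key y fun x hx => ?_
      obtain ⟨h1, h2⟩ := hk x y hy0 hx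
      have := hN x (h2.trans hyN)
      rw [h1]; linarith
  · have hk : ∀ x y, 0 ≤ y → stepKer x y ≠ 0 → stepKer x y = 1 ∧ y < x := by
      intro x y hy
      unfold stepKer
      split_ifs <;> first | omega | simp_all
    rcases st with h | h <;> obtain ⟨N, hN⟩ := Filter.eventually_atTop.1 h
    · filter_upwards [Filter.eventually_ge_atTop 0, Filter.eventually_ge_atTop N] with y hy0 hyN
      refine key y fun x hx => ?_
      obtain ⟨h1, h2⟩ := hk x y hy0 hx
      have := hN x (hyN.trans h2.le)
      rw [h1]; linarith
    · filter_upwards [Filter.eventually_ge_atTop 0, Filter.eventually_ge_atTop N] with y hy0 hyN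
      refine key' y fun x hx => ?_
      obtain ⟨h1, h2⟩ := hk x y hy0 hx
      have := hN x (hyN.trans h2.le)
      rw [h1]; linarith

end Tails

theorem abs_stepKer_le_one (x y : ℤ) : |stepKer x y| ≤ 1 := by
  unfold stepKer
  split_ifs <;> norm_num

/-- Tonelli, summing over `x` first. -/
theorem summable_prod_stepKer {B D : ℤ → ℝ} (hB : Summable B) (hB0 : ∀ x, 0 ≤ B x)
    (hD0 : ∀ y, 0 ≤ D y) (h : Summable fun y => (∑' x, B x * |stepKer x y|) * D y) :
    Summable fun z : ℤ × ℤ => B z.1 * |stepKer z.1 z.2| * D z.2 := by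
  rw [← (Equiv.prodComm ℤ ℤ).summable_iff]
  have hx : ∀ y, Summable fun x => B x * |stepKer x y| := fun y =>
    hB.of_nonneg_of_le (fun x => mul_nonneg (hB0 x) (abs_nonneg _))
      (fun x => mul_le_of_le_one_right (hB0 x) (abs_stepKer_le_one x y))
  rw [summable_prod_of_nonneg]
  · refine ⟨fun y => (hx y).mul_right (D y), ?_⟩
    simpa [tsum_mul_right] using h
  · exact fun z => mul_nonneg (mul_nonneg (hB0 _) (abs_nonneg _)) (hD0 _)

/-- Summation by parts on `ℤ`, where the summability of one side is a conclusion. -/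
theorem summation_by_parts {B C : ℤ → ℝ} (hBC : ∀ j, B j = C (j - 1) - C j) (hB : Summable B)
    (htop : Filter.Tendsto C Filter.atTop (nhds 0)) (hbot : Filter.Tendsto C Filter.atBot (nhds 0))
    (st : (∀ᶠ j in Filter.atTop, 0 ≤ B j) ∨ (∀ᶠ j in Filter.atTop, B j ≤ 0))
    (sb : (∀ᶠ j in Filter.atBot, 0 ≤ B j) ∨ (∀ᶠ j in Filter.atBot, B j ≤ 0))
    (h : ℤ → ℝ) (hs : Summable fun j => C j * (h (j + 1) - h j)) :
    Summable (fun j => B j * h j) ∧ ∑' j, B j * h j = ∑' j, C j * (h (j + 1) - h j) := by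
  -- For all but finitely many `y`, the absolute sum over `x` is `|C y| * |h (y + 1) - h y|`, which
  -- is summable. Summing this double series in the two orders gives the two sides, with `h - h 0`
  -- in place of `h`; the constant `h 0` drops out because `B` has sum zero.
  have hF : Summable fun z : ℤ × ℤ => B z.1 * stepKer z.1 z.2 * (h (z.2 + 1) - h z.2) := by
    have := summable_prod_stepKer (B := fun x => |B x|) (D := fun y => |h (y + 1) - h y|) hB.abs
      (fun _ => abs_nonneg _) (fun _ => abs_nonneg _) (by
        refine Summable.of_norm_bounded_eventually hs.abs ?_
        filter_upwards [eventually_tsum_abs_mul_stepKer hBC hB htop hbot st sb] with y hy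
        rw [hy, ← abs_mul, Real.norm_eq_abs, abs_abs])
    rw [← summable_abs_iff]
    simpa [abs_mul] using this
  have hrow : ∀ x, ∑' y, B x * stepKer x y * (h (y + 1) - h y) = B x * (h x - h 0) := fun x => by
    simp_rw [mul_assoc, tsum_mul_left, (hasSum_stepKer h x).tsum_eq]
  have h1 : Summable fun x => B x * (h x - h 0) := by
    simpa only [hrow] using hF.prod
  have h2 := hF.tsum_prod
  have h3 := ((Equiv.prodComm ℤ ℤ).summable_iff.2 hF).tsum_prod
  have h4 := (Equiv.prodComm ℤ ℤ).tsum_eq (fun z : ℤ × ℤ =>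
    B z.1 * stepKer z.1 z.2 * (h (z.2 + 1) - h z.2))
  simp only [Function.comp_def] at h3
  rw [h4, h2] at h3
  simp only [hrow, Equiv.prodComm_apply, Prod.fst_swap, Prod.snd_swap,
    tsum_mul_right, (hasSum_mul_stepKer hBC hB htop hbot _).tsum_eq] at h3
  have e : (fun j => B j * h j) = fun j => B j * (h j - h 0) + B j * h 0 := by funext j; ring
  refine ⟨e ▸ h1.add (hB.mul_right _), ?_⟩
  rw [e, h1.tsum_add (hB.mul_right _), tsum_mul_right,
    (hasSum_telescope hBC hB htop hbot).tsum_eq, h3]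
  simp

/-- A weighted Hardy inequality for square sums. -/
theorem summable_sq_of_summable_fwdDiff_sq {w C : ℤ → ℝ} (hw0 : ∀ x, 0 ≤ w x)
    (hw1 : Summable fun x : ℤ => |(x : ℝ)| * w x) (hw : Summable w)
    (hT : ∀ᶠ y in Filter.cofinite, ∑' x : ℤ, |(x : ℝ)| * w x * |stepKer x y| ≤ C y)
    (h : ℤ → ℝ) (hs : Summable fun j => C j * (h (j + 1) - h j) ^ 2) :
    Summable fun j => h j ^ 2 * w j := by
  -- The Cauchy–Schwarz bound for `(h x - h 0) ^ 2`, weighted by `w x`, is a row sum of this double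
  -- series; its column sums are controlled by `hT`.
  have hF := summable_prod_stepKer (B := fun x : ℤ => |(x : ℝ)| * w x)
    (D := fun y => (h (y + 1) - h y) ^ 2) hw1 (fun x => mul_nonneg (abs_nonneg _) (hw0 x))
      (fun _ => sq_nonneg _) (by
        refine Summable.of_norm_bounded_eventually hs ?_
        filter_upwards [hT] with y hy
        rw [Real.norm_eq_abs, abs_of_nonneg]
        · exact mul_le_mul_of_nonneg_right hy (sq_nonneg _)
        · exact mul_nonneg (tsum_nonneg fun x => mul_nonneg (mul_nonneg (abs_nonneg _) (hw0 x))
            (abs_nonneg _)) (sq_nonneg _))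
  have h1 := hF.prod
  simp only [mul_assoc, tsum_mul_left] at h1
  refine ((h1.mul_left 2).add (hw.mul_left (2 * h 0 ^ 2))).of_nonneg_of_le
    (fun x => mul_nonneg (sq_nonneg _) (hw0 x)) fun x => ?_
  have h2 := mul_le_mul_of_nonneg_right (sq_sub_le_stepKer h x) (hw0 x)
  have h3 : h x ^ 2 ≤ 2 * (h x - h 0) ^ 2 + 2 * h 0 ^ 2 := by nlinarith [sq_nonneg (h x - 2 * h 0)]
  have h4 := mul_le_mul_of_nonneg_right h3 (hw0 x)
  linarith

end CumOrd

/-! ### The weights, their positivity and the Rodrigues formula -/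

namespace CumOrd

/-- The weight `q^{[i]} p`. -/
def wt (q p : ℤ → ℝ) (i : ℕ) (j : ℤ) : ℝ := ascPow q i j * p j

/-- The `t`-th iterate of the negated backward difference `w ↦ w (· - 1) - w`. -/
def backDiff : ℕ → (ℤ → ℝ) → ℤ → ℝ
  | 0, w, j => w j
  | t + 1, w, j => backDiff t w (j - 1) - backDiff t w j

/-- Each backward difference absorbs one unit of the shift by `t` in the Rodrigues function. -/
theorem backDiff_eq (t : ℕ) (w : ℤ → ℝ) (j : ℤ) :
    (-1) ^ t * diff t (fun x => w (x - t)) j = backDiff t w j := by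
  have hshift : ∀ (t : ℕ) (f : ℤ → ℝ) (s j : ℤ), diff t (fun x => f (x + s)) j = diff t f (j + s) :=
    fun t f s j => fwdDiff_iter_comp_add 1 f s t j
  induction t generalizing j with
  | zero => simp [diff, backDiff]
  | succ t ih =>
    rw [backDiff, ← ih, ← ih]
    have e : (fun x : ℤ => w (x - (t + 1 : ℕ))) = fun x => (fun y => w (y - t)) (x + (-1)) := by
      funext x
      congr 1
      push_cast
      ring
    rw [e, hshift (t + 1) (fun y => w (y - t))]
    simp only [diff, Function.iterate_succ', Function.comp_apply, fwdDiff]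
    rw [neg_add_cancel_right, ← sub_eq_add_neg]
    ring

theorem ascPow_succ (q : ℤ → ℝ) (i : ℕ) (j : ℤ) : ascPow q (i + 1) j = ascPow q i j * q (j + i) := by
  simp [ascPow, Finset.prod_range_succ]

theorem ascPow_succ' (q : ℤ → ℝ) (i : ℕ) (j : ℤ) :
    ascPow q (i + 1) j = q j * ascPow q i (j + 1) := by
  simp only [ascPow, Finset.prod_range_succ', Nat.cast_zero, add_zero, mul_comm (q j)]
  congr 1
  refine Finset.prod_congr rfl fun r _ => ?_
  congr 1
  push_cast
  ring

theorem wt_zero (q p : ℤ → ℝ) : wt q p 0 = p := by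
  funext j
  simp [wt, ascPow]

theorem wt_succ (q p : ℤ → ℝ) (i : ℕ) (j : ℤ) : wt q p (i + 1) j = q (j + i) * wt q p i j := by
  rw [wt, wt, ascPow_succ]
  ring

theorem HasLead.quad (δ β γ : ℝ) : HasLead 2 δ (quad δ β γ) := by
  have h2 : HasLead 2 (1 * 1) (fun j => (j : ℝ) * (j : ℝ)) := HasLead.cast.mul HasLead.cast
  refine (((h2.const_mul δ).add ((HasLead.cast.const_mul β).of_lt one_lt_two)).add
    ((HasLead.const γ).of_lt two_pos)).congr (fun j => ?_) (by ring)
  simp only [CumOrd.quad]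
  ring

theorem HasLead.ascPow {q : ℤ → ℝ} {n : ℕ} {c : ℝ} (hq : HasLead n c q) (i : ℕ) :
    HasLead (n * i) (c ^ i) (ascPow q i) := by
  induction i with
  | zero => exact (HasLead.const 1).congr (fun j => by simp [CumOrd.ascPow]) (by simp)
  | succ i ih => exact (ih.mul (hq.shift i)).congr (ascPow_succ q i) (pow_succ _ _)

/-- A nonnegative summable sequence with `q(j) p(j) - q(j-1) p(j-1) = (μ - j) p(j)` for the
quadratic `q`, and with `q p` vanishing at `±∞`. -/
structure OrdSeq (p : ℤ → ℝ) (μ δ β γ : ℝ) : Prop where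
  nonneg : ∀ j, 0 ≤ p j
  rec_eq : ∀ j : ℤ, quad δ β γ j * p j - quad δ β γ (j - 1) * p (j - 1) = (μ - j) * p j
  tendsto_atTop : Filter.Tendsto (fun j => quad δ β γ j * p j) Filter.atTop (nhds 0)
  tendsto_atBot : Filter.Tendsto (fun j => quad δ β γ j * p j) Filter.atBot (nhds 0)

theorem tendsto_zero_atTop_of_summable {f : ℤ → ℝ} (hf : Summable f) :
    Filter.Tendsto f Filter.atTop (nhds 0) :=
  hf.tendsto_cofinite_zero.mono_left (by rw [Int.cofinite_eq]; exact le_sup_right)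

theorem tendsto_zero_atBot_of_summable {f : ℤ → ℝ} (hf : Summable f) :
    Filter.Tendsto f Filter.atBot (nhds 0) :=
  hf.tendsto_cofinite_zero.mono_left (by rw [Int.cofinite_eq]; exact le_sup_left)

theorem le_of_forall_step_le {C : ℤ → ℝ} {j : ℤ} (h : ∀ i ≤ j, C (i - 1) ≤ C i) {i : ℤ}
    (hi : i ≤ j) : C i ≤ C j := by
  induction i, hi using Int.leInductionDown with
  | base => exact le_rfl
  | pred n hn ih => exact (h n hn).trans ih

theorem le_of_forall_le_step {C : ℤ → ℝ} {j : ℤ} (h : ∀ i, j ≤ i → C (i + 1) ≤ C i) {i : ℤ}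
    (hi : j ≤ i) : C i ≤ C j := by
  induction i, hi using Int.leInduction with
  | base => exact le_rfl
  | succ n hn ih => exact (h n hn).trans ih

namespace OrdSeq

variable {p : ℤ → ℝ} {μ δ β γ : ℝ} (H : OrdSeq p μ δ β γ)

include H

theorem flux_mono {j : ℤ} (hj : (j : ℝ) ≤ μ) {i : ℤ} (hi : i ≤ j) :
    quad δ β γ i * p i ≤ quad δ β γ j * p j := by
  refine le_of_forall_step_le (C := fun j => quad δ β γ j * p j) (fun i hi => ?_) hi
  have : (i : ℝ) ≤ j := by exact_mod_cast hi
  have h := H.rec_eq i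
  have := mul_nonneg (by linarith : 0 ≤ μ - i) (H.nonneg i)
  linarith

theorem flux_anti {j : ℤ} (hj : μ ≤ (j : ℝ) + 1) {i : ℤ} (hi : j ≤ i) :
    quad δ β γ i * p i ≤ quad δ β γ j * p j := by
  refine le_of_forall_le_step (C := fun j => quad δ β γ j * p j) (fun i hi => ?_) hi
  have : (j : ℝ) ≤ i := by exact_mod_cast hi
  have h := H.rec_eq (i + 1)
  have := mul_nonneg (by push_cast; linarith : 0 ≤ ((i + 1 : ℤ) : ℝ) - μ) (H.nonneg (i + 1))
  rw [add_sub_cancel_right] at h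
  linarith

/-- The flux `q p` has increments `(μ - j) p j`, so it rises up to the mean, falls after it, and
tends to zero at both ends. -/
theorem flux_nonneg (j : ℤ) : 0 ≤ quad δ β γ j * p j := by
  rcases le_total (j : ℝ) μ with hj | hj
  · exact le_of_tendsto H.tendsto_atBot
      ((Filter.eventually_le_atBot j).mono fun i hi => H.flux_mono hj hi)
  · exact le_of_tendsto H.tendsto_atTop
      ((Filter.eventually_ge_atTop j).mono fun i hi => H.flux_anti (by linarith) hi)

/-- Left of the mean, the mass at `a` has already made the flux jump up; right of it, the mass at
`b` still has to make it drop. Together with `pos_succ` this shows that the support has no gaps. -/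
theorem flux_pos {a b j : ℤ} (ha : 0 < p a) (hb : 0 < p b) (haj : a ≤ j) (hjb : j < b) :
    0 < quad δ β γ j * p j := by
  have haj' : (a : ℝ) ≤ j := by exact_mod_cast haj
  have hjb' : (j : ℝ) + 1 ≤ b := by exact_mod_cast hjb
  rcases lt_or_ge (j : ℝ) μ with hj | hj
  · refine lt_of_lt_of_le ?_ (H.flux_mono hj.le haj)
    have h := H.rec_eq a
    have h1 := H.flux_nonneg (a - 1)
    have := mul_pos (by linarith : 0 < μ - a) ha
    linarith
  · refine lt_of_lt_of_le ?_ (H.flux_anti (by linarith) (Int.le_sub_one_of_lt hjb))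
    have h := H.rec_eq b
    have h1 := H.flux_nonneg b
    have := mul_pos (by linarith : 0 < (b : ℝ) - μ) hb
    linarith

theorem quad_nonneg {j : ℤ} (hj : 0 < p j) : 0 ≤ quad δ β γ j :=
  nonneg_of_mul_nonneg_left (H.flux_nonneg j) hj

theorem pos_succ {j : ℤ} (hj : 0 < quad δ β γ j * p j) : 0 < p (j + 1) := by
  refine lt_of_le_of_ne (H.nonneg _) fun h0 => ?_
  have := H.rec_eq (j + 1)
  rw [← h0, add_sub_cancel_right] at this
  linarith

/-- The two claims need a joint induction: `q` may be negative off the support, but positivity of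
`w_i` at `j` places `j + i` in the support, where `q` is nonnegative. -/
theorem wt_nonneg_and (i : ℕ) (j : ℤ) : 0 ≤ wt (quad δ β γ) p i j ∧
    (0 < wt (quad δ β γ) p i j → 0 < p j ∧ 0 < p (j + i)) := by
  have hr (i : ℕ) (j : ℤ) (h0 : 0 < ascPow (quad δ β γ) i j) (hp : 0 < p j) (hpi : 0 < p (j + i)) :
      0 ≤ wt (quad δ β γ) p (i + 1) j ∧
      (0 < wt (quad δ β γ) p (i + 1) j → 0 < p j ∧ 0 < p (j + (i + 1 : ℕ))) := by
    have hq := H.quad_nonneg hpi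
    have hw : 0 < wt (quad δ β γ) p i j := mul_pos h0 hp
    rw [wt_succ]
    refine ⟨mul_nonneg hq hw.le, fun h => ⟨hp, ?_⟩⟩
    have := H.pos_succ (mul_pos (pos_of_mul_pos_left h hw.le) hpi)
    rwa [Nat.cast_succ, ← add_assoc]
  induction i with
  | zero => simpa [wt_zero] using H.nonneg j
  | succ i ih =>
    rcases ih.1.lt_or_eq with h | h
    · obtain ⟨h1, h2⟩ := ih.2 h
      exact hr i j (pos_of_mul_pos_left h h1.le) h1 h2
    · rw [wt_succ, ← h]
      simp

theorem wt_nonneg (i : ℕ) (j : ℤ) : 0 ≤ wt (quad δ β γ) p i j := (H.wt_nonneg_and i j).1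

theorem wt_pos {a : ℤ} {k : ℕ} (ha : 0 < p a) (hb : 0 < p (a + k)) :
    0 < wt (quad δ β γ) p k a := by
  refine mul_pos (Finset.prod_pos fun r hr => ?_) ha
  have hr : r < k := Finset.mem_range.1 hr
  exact pos_of_mul_pos_left (H.flux_pos ha hb (by omega : a ≤ a + r) (by omega)) (H.nonneg _)

/-- The left side contains the factor `q(j-1) p(j-1)`, which the recurrence turns into a polynomial
times `p j`. Thus both `w_{i+1}(j)` and `w_{i+1}(j-1)` are polynomial multiples of `w_i(j)`. -/
theorem wt_succ_pred (i : ℕ) (j : ℤ) :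
    wt (quad δ β γ) p (i + 1) (j - 1) = (quad δ β γ j - μ + j) * wt (quad δ β γ) p i j := by
  rw [wt, wt, ascPow_succ', sub_add_cancel]
  linear_combination -ascPow (quad δ β γ) i j * H.rec_eq j

omit H in
theorem hasLead_slope (i : ℕ) :
    HasLead 1 (2 * i * δ - 1) (fun j => quad δ β γ (j + i) - quad δ β γ j + μ - j) := by
  refine ((((HasLead.quad δ β γ).diff_shift i).add ((HasLead.const μ).of_lt one_pos)).sub
    HasLead.cast).congr (fun j => rfl) ?_
  push_cast
  ring

theorem wt_succ_sub (i : ℕ) (j : ℤ) :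
    wt (quad δ β γ) p (i + 1) j - wt (quad δ β γ) p (i + 1) (j - 1)
      = (quad δ β γ (j + i) - quad δ β γ j + μ - j) * wt (quad δ β γ) p i j := by
  rw [H.wt_succ_pred, wt_succ]
  ring

/-- The Rodrigues formula: iterated differences of a weight are polynomial multiples of a weight
of lower index. -/
theorem exists_backDiff_wt (t i : ℕ) :
    ∃ f, HasLead t (∏ m ∈ Finset.range t, (1 - (2 * ((i : ℝ) + t) - 2 - m) * δ)) f ∧
      ∀ j, backDiff t (wt (quad δ β γ) p (i + t)) j = f j * wt (quad δ β γ) p i j := by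
  -- The factors depend on `i` and `t` only through `i + t`, so this sum is fixed while `t` grows
  -- and `i` falls.
  suffices h : ∀ (k t i : ℕ), i + t = k →
      ∃ f, HasLead t (∏ m ∈ Finset.range t, (1 - (2 * (k : ℝ) - 2 - m) * δ)) f ∧
      ∀ j, backDiff t (wt (quad δ β γ) p k) j = f j * wt (quad δ β γ) p i j by
    simpa using h (i + t) t i rfl
  intro k t
  induction t with
  | zero =>
    rintro i rfl
    exact ⟨fun _ => 1, (HasLead.const 1).congr (fun _ => rfl) (by simp), by simp [backDiff]⟩
  | succ t ih =>
    intro i hk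
    obtain ⟨f, hf, hfw⟩ := ih (i + 1) (by omega)
    set c := ∏ m ∈ Finset.range t, (1 - (2 * (k : ℝ) - 2 - m) * δ) with hc
    -- Discrete product rule for `f w_{i+1}`: one term differences `f`, the other differences
    -- `w_{i+1}`. The top coefficients `-t c δ` and `-c (2 i δ - 1)` add up to `c (1 - (2 i + t)
    -- δ)`.
    refine ⟨fun j => (f (j + (-1)) - f j) * quad δ β γ (j + i)
      - f (j + (-1)) * (quad δ β γ (j + i) - quad δ β γ j + μ - j), ?_, fun j => ?_⟩
    · have h1 : HasLead (t + 1) (-(t * c * δ))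
          (fun j => (f (j + (-1)) - f j) * quad δ β γ (j + i)) := by
        cases t with
        | zero =>
          refine ((HasLead.const 0).of_lt one_pos).congr (fun j => ?_) (by simp)
          obtain ⟨P, hP, -, hPf⟩ := hf
          rw [Polynomial.eq_C_of_natDegree_le_zero hP] at hPf
          simp [hPf]
        | succ t =>
          exact ((hf.diff_shift (-1)).mul ((HasLead.quad δ β γ).shift i)).congr (fun _ => rfl)
            (by push_cast; ring)
      refine (h1.sub ((hf.shift (-1)).mul (hasLead_slope (μ := μ) i))).congr (fun _ => rfl) ?_
      rw [Finset.prod_range_succ, ← hc, ← hk]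
      push_cast
      ring
    · rw [backDiff, hfw, hfw, H.wt_succ_pred, wt_succ]
      simp only [← sub_eq_add_neg]
      ring

section Moments

variable {N : ℕ} (hm : Summable fun j : ℤ => (1 + |(j : ℝ)|) ^ N * p j)

include hm

theorem summable_mul {n : ℕ} {c : ℝ} {f : ℤ → ℝ} (hf : HasLead n c f) (hn : n ≤ N) :
    Summable fun j => f j * p j := by
  obtain ⟨K, hK, hb⟩ := hf.exists_bound
  refine Summable.of_norm_bounded (hm.mul_left K) fun j => ?_
  rw [Real.norm_eq_abs, abs_mul, abs_of_nonneg (H.nonneg j), ← mul_assoc]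
  refine mul_le_mul_of_nonneg_right ((hb j).trans ?_) (H.nonneg j)
  gcongr
  linarith [abs_nonneg (j : ℝ)]

theorem summable_mul_wt {n i : ℕ} {c : ℝ} {f : ℤ → ℝ} (hf : HasLead n c f)
    (hn : n + 2 * i ≤ N) : Summable fun j => f j * wt (quad δ β γ) p i j := by
  simpa [wt, mul_assoc] using H.summable_mul hm (hf.mul ((HasLead.quad δ β γ).ascPow i)) hn

theorem summable_wt {i : ℕ} (hn : 2 * i ≤ N) : Summable (wt (quad δ β γ) p i) := by
  simpa using H.summable_mul_wt hm (HasLead.const 1) (by omega : 0 + 2 * i ≤ N)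

theorem summable_backDiff {t i : ℕ} (hn : t + 2 * i ≤ N) :
    Summable (backDiff t (wt (quad δ β γ) p (i + t))) := by
  obtain ⟨f, hf, hfw⟩ := H.exists_backDiff_wt t i
  exact (H.summable_mul_wt hm hf hn).congr fun j => (hfw j).symm

/-- Moving differences from the weights to the function by repeated summation by parts. -/
theorem tsum_backDiff_mul {k : ℕ} (hN : 2 * k ≤ N) (t u i : ℕ) (hk : i + t + u = k) (h : ℤ → ℝ)
    (hs : Summable fun j => backDiff u (wt (quad δ β γ) p k) j * diff t h j) :
    Summable (fun j => backDiff (u + t) (wt (quad δ β γ) p k) j * h j) ∧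
      ∑' j, backDiff (u + t) (wt (quad δ β γ) p k) j * h j
        = ∑' j, backDiff u (wt (quad δ β γ) p k) j * diff t h j := by
  induction t generalizing i h with
  | zero => exact ⟨by simpa [diff] using hs, by simp [diff]⟩
  | succ t ih =>
    have e : diff (t + 1) h = diff t (fwdDiff 1 h) := by simp [diff]
    rw [e] at hs ⊢
    obtain ⟨h1, h2⟩ := ih (i + 1) (by omega) _ hs
    have hC := H.summable_backDiff hm (t := u + t) (i := i + 1) (by omega)
    have hB := H.summable_backDiff hm (t := u + (t + 1)) (i := i) (by omega)
    rw [show i + 1 + (u + t) = k by omega] at hC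
    obtain ⟨f, hf, hfw⟩ := H.exists_backDiff_wt (u + (t + 1)) i
    rw [show i + (u + (t + 1)) = k by omega] at hfw hB
    have hw := H.wt_nonneg i
    -- By the Rodrigues formula `B` is a polynomial times a nonnegative weight, which gives the sign
    -- conditions.
    have := summation_by_parts (B := backDiff (u + (t + 1)) (wt (quad δ β γ) p k))
      (C := backDiff (u + t) (wt (quad δ β γ) p k)) (fun _ => rfl) hB
      (tendsto_zero_atTop_of_summable hC) (tendsto_zero_atBot_of_summable hC)
      (hf.eventually_sign_atTop.imp
        (fun h => h.mono fun j hj => by rw [hfw]; exact mul_nonneg hj (hw j))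
        (fun h => h.mono fun j hj => by rw [hfw]; exact mul_nonpos_of_nonpos_of_nonneg hj (hw j)))
      (hf.eventually_sign_atBot.imp
        (fun h => h.mono fun j hj => by rw [hfw]; exact mul_nonneg hj (hw j))
        (fun h => h.mono fun j hj => by rw [hfw]; exact mul_nonpos_of_nonpos_of_nonneg hj (hw j)))
      h h1
    exact ⟨this.1, this.2.trans h2⟩

/-- Otherwise the affine factor in the increments of `w_{i+1}` is nondecreasing. Starting from `j₀`,
the weight would then not decrease in one of the two directions, although it is positive at `j₀` and
tends to zero at both ends. -/
theorem one_sub_pos {i : ℕ} (hN : 2 * (i + 1) ≤ N) {j₀ : ℤ}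
    (hj₀ : 0 < wt (quad δ β γ) p (i + 1) j₀) : 0 < 1 - 2 * i * δ := by
  by_contra! hd
  have hsl : ∀ j : ℤ, quad δ β γ (j + i) - quad δ β γ j + μ - j
      = (2 * i * δ - 1) * j + (δ * i ^ 2 + β * i + μ) := by
    intro j
    simp only [quad]
    push_cast
    ring
  have hs := H.summable_wt hm hN
  rcases le_or_gt ((2 * i * δ - 1) * j₀ + (δ * i ^ 2 + β * i + μ)) 0 with h0 | h0
  · refine hj₀.not_ge (ge_of_tendsto (tendsto_zero_atBot_of_summable hs)
      ((Filter.eventually_le_atBot j₀).mono fun a ha => ?_))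
    have : -wt (quad δ β γ) p (i + 1) a ≤ -wt (quad δ β γ) p (i + 1) j₀ := by
      refine le_of_forall_step_le (C := fun a => -wt (quad δ β γ) p (i + 1) a) (fun b hb => ?_) ha
      have h1 := H.wt_succ_sub i b
      rw [hsl] at h1
      have hb' : (b : ℝ) ≤ j₀ := by exact_mod_cast hb
      have h2 : (2 * i * δ - 1) * b + (δ * i ^ 2 + β * i + μ) ≤ 0 := by nlinarith
      have := mul_nonpos_of_nonpos_of_nonneg h2 (H.wt_nonneg i b)
      linarith
    linarith
  · refine hj₀.not_ge (ge_of_tendsto (tendsto_zero_atTop_of_summable hs)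
      ((Filter.eventually_ge_atTop j₀).mono fun a ha => ?_))
    have : -wt (quad δ β γ) p (i + 1) a ≤ -wt (quad δ β γ) p (i + 1) j₀ := by
      refine le_of_forall_le_step (C := fun a => -wt (quad δ β γ) p (i + 1) a) (fun b hb => ?_) ha
      have h1 := H.wt_succ_sub i (b + 1)
      rw [hsl, add_sub_cancel_right] at h1
      have hb' : (j₀ : ℝ) ≤ b := by exact_mod_cast hb
      have h2 : 0 ≤ (2 * i * δ - 1) * ((b + 1 : ℤ) : ℝ) + (δ * i ^ 2 + β * i + μ) := by
        push_cast
        nlinarith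
      have := mul_nonneg h2 (H.wt_nonneg i (b + 1))
      linarith
    linarith

end Moments

end OrdSeq

end CumOrd

/-! ### Laws on the integers, norming constants and Fourier coefficients -/

namespace CumOrd

section Law

variable {p : ℤ → ℝ} (hp : ∀ j, 0 ≤ p j) (f : ℤ → ℝ)

include hp

theorem integrable_lawOf_iff : Integrable f (lawOf p) ↔ Summable fun j => f j * p j := by
  rw [lawOf, integrable_withDensity_iff_integrable_smul' (measurable_of_countable _)
    (by simp), integrable_count_iff, ← summable_norm_iff (f := fun j => f j * p j)]
  simp [ENNReal.toReal_ofReal (hp _), mul_comm]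

theorem integral_lawOf : ∫ j, f j ∂(lawOf p) = ∑' j, f j * p j := by
  by_cases hf : Integrable f (lawOf p)
  · have hs := (integrable_lawOf_iff hp f).1 hf
    rw [lawOf, integral_withDensity_eq_integral_toReal_smul (measurable_of_countable _)
      (by simp)]
    simp only [ENNReal.toReal_ofReal (hp _), smul_eq_mul]
    rw [integral_countable (by
      rw [integrable_count_iff]; exact (hs.congr fun j => mul_comm _ _).norm)]
    simp [Measure.real, mul_comm]
  · rw [integral_undef hf, tsum_eq_zero_of_not_summable (mt (integrable_lawOf_iff hp f).2 hf)]

theorem memLp_two_lawOf_iff : MemLp f 2 (lawOf p) ↔ Summable fun j => f j ^ 2 * p j := by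
  rw [memLp_two_iff_integrable_sq (measurable_of_countable _).aestronglyMeasurable,
    integrable_lawOf_iff hp]

end Law

section PmfOf

variable {Ω : Type*} [MeasurableSpace Ω] (P : Measure Ω) {X : Ω → ℤ}

theorem pmfOf_nonneg (X : Ω → ℤ) (j : ℤ) : 0 ≤ pmfOf P X j := measureReal_nonneg

variable [IsProbabilityMeasure P]

theorem map_eq_lawOf (hX : Measurable X) : P.map X = lawOf (pmfOf P X) := by
  refine Measure.ext_of_singleton fun j => ?_
  rw [Measure.map_apply hX (measurableSet_singleton j), lawOf,
    withDensity_apply _ (measurableSet_singleton j), Measure.restrict_singleton]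
  simp [pmfOf, Measure.real]

theorem integrable_comp_iff (hX : Measurable X) (f : ℤ → ℝ) :
    Integrable (fun ω => f (X ω)) P ↔ Summable fun j => f j * pmfOf P X j := by
  rw [← integrable_lawOf_iff (pmfOf_nonneg P X), ← map_eq_lawOf P hX,
    integrable_map_measure (measurable_of_countable _).aestronglyMeasurable hX.aemeasurable]
  rfl

theorem integral_comp_eq (hX : Measurable X) (f : ℤ → ℝ) :
    ∫ ω, f (X ω) ∂P = ∑' j, f j * pmfOf P X j := by
  rw [← integral_lawOf (pmfOf_nonneg P X), ← map_eq_lawOf P hX,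
    integral_map hX.aemeasurable (measurable_of_countable _).aestronglyMeasurable]

theorem hasSum_pmfOf (hX : Measurable X) : HasSum (pmfOf P X) 1 := by
  have h1 : Summable fun j => (1 : ℝ) * pmfOf P X j :=
    (integrable_comp_iff P hX fun _ => 1).1 (integrable_const _)
  have h2 := integral_comp_eq P hX fun _ => 1
  simp only [one_mul, integral_const, probReal_univ, smul_eq_mul] at h1 h2
  exact h2 ▸ h1.hasSum

/-- Differencing the cumulative identity gives the recurrence. The limit at `+∞` is the full sum of
`(μ - k) p k`, which is zero because `μ` is the mean. -/
theorem IsCO.ordSeq {μ δ β γ : ℝ} (h : IsCO P X μ δ β γ) : OrdSeq (pmfOf P X) μ δ β γ := by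
  have hX := h.measurable
  have hp := hasSum_pmfOf P hX
  have h1 := (integrable_comp_iff P hX fun j => (j : ℝ)).1 h.integrable
  have hs : Summable fun j : ℤ => (μ - j) * pmfOf P X j := by
    simpa [sub_mul] using (hp.summable.mul_left μ).sub h1
  have h0 : ∑' j : ℤ, (μ - j) * pmfOf P X j = 0 := by
    have := (hp.mul_left μ).sub h1.hasSum
    rw [← integral_comp_eq P hX (fun j => (j : ℝ)), h.mean_eq, mul_one, sub_self] at this
    simpa [sub_mul] using this.tsum_eq
  have hind (j : ℤ) : quad δ β γ j * pmfOf P X j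
      = ∑' k, (Set.Iic j).indicator (fun k : ℤ => (μ - k) * pmfOf P X k) k := by
    rw [← h.cumulative j, tsum_subtype (Set.Iic j) (fun k : ℤ => (μ - k) * pmfOf P X k)]
  refine ⟨pmfOf_nonneg P X, fun j => ?_, ?_, ?_⟩
  · rw [hind, hind, ← (hs.indicator _).tsum_sub (hs.indicator _)]
    rw [tsum_eq_single j]
    · simp
    · intro k hk
      by_cases hkj : k ≤ j
      · have : k ≤ j - 1 := by omega
        simp [Set.indicator, hkj, this]
      · have : ¬ k ≤ j - 1 := by omega
        simp [Set.indicator, hkj, this]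
  · simp only [hind]
    rw [← h0]
    refine tendsto_tsum_of_dominated_convergence hs.norm (fun k => ?_)
      (.of_forall fun j k => norm_indicator_le_norm_self _ _)
    refine tendsto_const_nhds.congr' ?_
    filter_upwards [Filter.eventually_ge_atTop k] with j hj
    simp [Set.indicator, hj]
  · simp only [hind]
    rw [← tsum_zero (β := ℤ)]
    refine tendsto_tsum_of_dominated_convergence hs.norm (fun k => ?_)
      (.of_forall fun j k => norm_indicator_le_norm_self _ _)
    refine tendsto_const_nhds.congr' ?_
    filter_upwards [Filter.eventually_lt_atBot k] with j hj
    simp [Set.indicator, hj.not_ge]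

end PmfOf

theorem momentA_eq {p : ℤ → ℝ} (hp : ∀ j, 0 ≤ p j) (q : ℤ → ℝ) (k : ℕ) :
    momentA p q k = ∑' j, wt q p k j := integral_lawOf hp _

theorem ascPow_add (q : ℤ → ℝ) (i t : ℕ) (j : ℤ) :
    ascPow q (i + t) j = ascPow q i j * ascPow q t (j + i) := by
  simp only [ascPow, Finset.prod_range_add, Nat.cast_add, add_assoc]

theorem backDiff_mul_const (t : ℕ) (w : ℤ → ℝ) (c : ℝ) (j : ℤ) :
    backDiff t (fun x => w x * c) j = backDiff t w j * c := by
  induction t generalizing j with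
  | zero => rfl
  | succ t ih => rw [backDiff, backDiff, ih, ih]; ring

/-- Reduces the Rodrigues function of `(p_i, q_i)` to differences of the original weight `w_{i+t}`.
-/
theorem ascPow_quadI_mul_pmfI (p q : ℤ → ℝ) (δ : ℝ) (i t : ℕ) (j : ℤ) :
    ascPow (quadI q δ i) t j * pmfI p q i j
      = wt q p (i + t) j * ((1 - 2 * i * δ) ^ t * momentA p q i)⁻¹ := by
  have : ascPow (quadI q δ i) t j = ascPow q t (j + i) / (1 - 2 * i * δ) ^ t := by
    simp only [ascPow, quadI, Finset.prod_div_distrib, Finset.prod_const, Finset.card_range]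
    congr 1
    exact Finset.prod_congr rfl fun r _ => by congr 1; ring
  rw [this, pmfI, wt, ascPow_add, mul_inv]
  ring

/-- The leading coefficient of the polynomial `backDiff t (q^{[i+t]} p) / (q^{[i]} p)`. -/
def leadCoef (δ : ℝ) (i t : ℕ) : ℝ :=
  ∏ m ∈ Finset.range t, (1 - (2 * ((i : ℝ) + t) - 2 - m) * δ)

theorem leadCoef_eq (δ : ℝ) (i t : ℕ) :
    leadCoef δ i t = ∏ r ∈ Finset.range t, (1 - ((i : ℝ) + t + i - 1 + r) * δ) := by
  rw [leadCoef, ← Finset.prod_range_reflect]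
  refine Finset.prod_congr rfl fun r hr => ?_
  have hr := Finset.mem_range.1 hr
  rw [Nat.cast_sub (by omega), Nat.cast_sub (by omega)]
  push_cast
  ring

/-- The alternative `t = 0` covers the top level `i = k`, where `1 - 2iδ` is not known to be nonzero
and both products are empty. -/
theorem leadC_deltaI {δ : ℝ} {i t : ℕ} (hd : 1 - 2 * i * δ ≠ 0 ∨ t = 0) :
    leadC t (deltaI δ i) = leadCoef δ i t / (1 - 2 * i * δ) ^ t := by
  rcases hd with hd | rfl
  · rw [leadCoef_eq, leadC, ← Finset.card_range t, ← Finset.prod_const, Finset.card_range,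
      ← Finset.prod_div_distrib]
    refine Finset.prod_congr rfl fun r _ => ?_
    have h := div_mul_cancel₀ δ hd
    rw [deltaI, eq_div_iff hd]
    generalize δ / (1 - 2 * i * δ) = x at h ⊢
    linear_combination (-((t : ℝ) - 1 + r)) * h
  · simp [leadC, leadCoef]

/-- The multipliers of `δ` are nonnegative and largest at `m = 0`, so the worst factor is the first
one if `δ ≥ 0`, while all factors are at least one if `δ ≤ 0`. -/
theorem leadCoef_pos {δ : ℝ} {i t : ℕ} (h : 0 < 1 - (2 * ((i : ℝ) + t) - 2) * δ) :
    0 < leadCoef δ i t := by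
  refine Finset.prod_pos fun m hm => ?_
  have hm : m + 1 ≤ t := Finset.mem_range.1 hm
  have hm' : (m : ℝ) + 1 ≤ t := by exact_mod_cast hm
  have hi : (0 : ℝ) ≤ i := i.cast_nonneg
  have hm0 : (0 : ℝ) ≤ m := m.cast_nonneg
  rcases le_total δ 0 with hδ | hδ
  · nlinarith
  · nlinarith

/-- With `k = i + t`, the factors of `c_k(δ)` split after the first `i`: these enter
`v^{(i)}_{k-i}`, the others norm the polynomial of level `i`. -/
theorem leadCoef_zero_mul (δ : ℝ) (i t : ℕ) :
    (∏ r ∈ Finset.range i, (1 - (((i + t : ℕ) : ℝ) - 1 + (r : ℝ)) * δ)) * leadCoef δ i t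
      = leadCoef δ 0 (i + t) := by
  rw [leadCoef_eq, leadCoef_eq, Finset.prod_range_add]
  congr 1
  · exact Finset.prod_congr rfl fun r _ => by push_cast; ring
  · exact Finset.prod_congr rfl fun r _ => by push_cast; ring

theorem stdPolyI_zero {p q : ℤ → ℝ} (δ : ℝ) (k : ℕ) (h : momentA p q 0 = 1) :
    stdPolyI p q δ k 0 = stdPoly p q δ k := by
  have h1 : pmfI p q 0 = p := by funext j; simp [pmfI, h, ascPow]
  have h2 : quadI q δ 0 = q := by funext j; simp [quadI]
  have h3 : deltaI δ 0 = δ := by simp [deltaI]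
  rw [stdPolyI, h1, h2, h3]

namespace OrdSeq

variable {p : ℤ → ℝ} {μ δ β γ : ℝ} (H : OrdSeq p μ δ β γ)

include H

theorem momentA_nonneg (k : ℕ) : 0 ≤ momentA p (quad δ β γ) k := by
  rw [momentA_eq H.nonneg]
  exact tsum_nonneg (H.wt_nonneg k)

theorem pmfI_nonneg (i : ℕ) (j : ℤ) : 0 ≤ pmfI p (quad δ β γ) i j :=
  div_nonneg (H.wt_nonneg i j) (H.momentA_nonneg i)

theorem stdPolyI_mul_pmfI {i t : ℕ} (hA : 0 < momentA p (quad δ β γ) i)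
    (hd : 0 < 1 - 2 * i * δ ∨ t = 0) (j : ℤ) :
    stdPolyI p (quad δ β γ) δ t i j * pmfI p (quad δ β γ) i j
      = backDiff t (wt (quad δ β γ) p (i + t)) j /
        √(t.factorial * leadCoef δ i t * momentA p (quad δ β γ) (i + t)
          * momentA p (quad δ β γ) i) := by
  set q := quad δ β γ
  set D := (1 - 2 * i * δ) ^ t with hD
  have hD0 : 0 < D := by
    rcases hd with hd | rfl
    · positivity
    · simp [hD]
  have hrod : rodrigues (pmfI p q i) (quadI q δ i) t j * pmfI p q i j
      = backDiff t (wt q p (i + t)) j * (D * momentA p q i)⁻¹ := by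
    have e : (fun s : ℤ => ascPow (quadI q δ i) t (s - t) * pmfI p q i (s - t))
        = fun s : ℤ => (fun x => wt q p (i + t) x * (D * momentA p q i)⁻¹) (s - t) := by
      funext s
      exact ascPow_quadI_mul_pmfI p q δ i t (s - t)
    rw [rodrigues, e, backDiff_eq t fun x => wt q p (i + t) x * (D * momentA p q i)⁻¹,
      backDiff_mul_const]
    -- Off the support of `p_i` the Rodrigues quotient is `0` by convention; the difference vanishes
    -- there too, being a multiple of `w_i`.
    by_cases h0 : pmfI p q i j = 0
    · obtain ⟨f, -, hf⟩ := H.exists_backDiff_wt t i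
      have hw : wt q p i j = 0 := by
        have : wt q p i j / momentA p q i = 0 := h0
        simpa [hA.ne'] using this
      rw [hf, hw, h0]
      simp
    · rw [div_mul_cancel₀ _ h0]
  have hmom : momentA (pmfI p q i) (quadI q δ i) t
      = momentA p q (i + t) / (D * momentA p q i) := by
    rw [momentA_eq (H.pmfI_nonneg i), momentA_eq H.nonneg, ← tsum_div_const]
    exact tsum_congr fun j => (ascPow_quadI_mul_pmfI p q δ i t j).trans (div_eq_mul_inv _ _).symm
  rw [stdPolyI, stdPoly, div_mul_eq_mul_div, hrod, hmom, leadC_deltaI (hd.imp_left ne_of_gt), ← hD,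
    ← div_eq_mul_inv, div_div]
  congr 1
  rw [← Real.sqrt_sq (by positivity : 0 ≤ D * momentA p q i), ← Real.sqrt_mul (sq_nonneg _),
    Real.sqrt_sq (by positivity : 0 ≤ D * momentA p q i)]
  congr 1
  field_simp

section Level

variable {k : ℕ} (hm : Summable fun j : ℤ => (1 + |(j : ℝ)|) ^ (2 * k) * p j) {j₀ : ℤ}
  (hj₀ : 0 < wt (quad δ β γ) p k j₀)

include hj₀

theorem wt_pos_of_le {i : ℕ} (hi : i ≤ k) : 0 < wt (quad δ β γ) p i j₀ := by
  obtain ⟨t, rfl⟩ := Nat.exists_eq_add_of_le hi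
  rw [wt, ascPow_add, mul_right_comm] at hj₀
  exact (H.wt_nonneg i j₀).lt_of_ne' (left_ne_zero_of_mul hj₀.ne')

include hm

theorem momentA_pos {i : ℕ} (hi : i ≤ k) : 0 < momentA p (quad δ β γ) i := by
  rw [momentA_eq H.nonneg]
  exact (H.summable_wt hm (by omega)).tsum_pos (H.wt_nonneg i) j₀ (H.wt_pos_of_le hj₀ hi)

theorem isPmf_pmfI {i : ℕ} (hi : i ≤ k) : IsPmf (pmfI p (quad δ β γ) i) := by
  refine ⟨H.pmfI_nonneg i, ?_⟩
  have hA := H.momentA_pos hm hj₀ hi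
  have := (H.summable_wt hm (by omega : 2 * i ≤ 2 * k)).hasSum.div_const (momentA p (quad δ β γ) i)
  rwa [← momentA_eq H.nonneg, div_self hA.ne'] at this

theorem one_sub_pos_of_lt {i : ℕ} (hi : i < k) : 0 < 1 - 2 * i * δ :=
  H.one_sub_pos hm (by omega) (H.wt_pos_of_le hj₀ hi)

theorem leadCoef_pos {i t : ℕ} (hk : i + t ≤ k) : 0 < leadCoef δ i t := by
  rcases Nat.eq_zero_or_pos (i + t) with h0 | h0
  · have : t = 0 := by omega
    simp [this, leadCoef]
  · have := H.one_sub_pos_of_lt hm hj₀ (i := i + t - 1) (by omega)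
    rw [Nat.cast_sub h0] at this
    push_cast at this
    exact CumOrd.leadCoef_pos (by convert this using 3; ring)

theorem weight_nonneg {i : ℕ} (hi : i ≤ k) : 0 ≤ weight δ k i := by
  obtain ⟨t, rfl⟩ := Nat.exists_eq_add_of_le hi
  have h1 := H.leadCoef_pos hm hj₀ (i := 0) (t := i + t) (by omega)
  have h2 := H.leadCoef_pos hm hj₀ (i := i) (t := t) le_rfl
  rw [← leadCoef_zero_mul δ i t] at h1
  have h3 := pos_of_mul_pos_left h1 h2.le
  unfold weight
  positivity

-- The difference is `a w_m` with `a` of degree at most `u`, and `|a f| ≤ a² + f²`; the first term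
-- needs moments of order `2u + 2m = 2k` only.
omit hj₀ in
theorem summable_backDiff_mul_of_sq {m u : ℕ} (hk : m + u = k) {f : ℤ → ℝ}
    (hf : Summable fun j => f j ^ 2 * wt (quad δ β γ) p m j) :
    Summable fun j => backDiff u (wt (quad δ β γ) p k) j * f j := by
  obtain ⟨a, ha, haw⟩ := H.exists_backDiff_wt u m
  rw [hk] at haw
  have h1 := H.summable_mul_wt hm (ha.mul ha) (by omega : u + u + 2 * m ≤ 2 * k)
  refine Summable.of_norm_bounded (h1.add hf) fun j => ?_
  have hw := H.wt_nonneg m j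
  rw [haw, Real.norm_eq_abs, show a j * wt (quad δ β γ) p m j * f j
    = a j * f j * wt (quad δ β γ) p m j by ring, abs_mul, abs_of_nonneg hw, ← add_mul]
  refine mul_le_mul_of_nonneg_right ?_ hw
  rw [abs_mul]
  nlinarith [sq_nonneg (|a j| - |f j|), sq_abs (a j), sq_abs (f j)]

theorem summable_sq_mul_wt {m : ℕ} (hmk : m ≤ k) {f : ℤ → ℝ}
    (hf : MemLp f 2 (lawOf (pmfI p (quad δ β γ) m))) :
    Summable fun j => f j ^ 2 * wt (quad δ β γ) p m j := by
  have hA := H.momentA_pos hm hj₀ hmk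
  rw [memLp_two_lawOf_iff (H.pmfI_nonneg m)] at hf
  refine (hf.mul_right (momentA p (quad δ β γ) m)).congr fun j => ?_
  rw [pmfI, wt]
  field_simp

variable (hA0 : momentA p (quad δ β γ) 0 = 1)

include hA0

/-- The Fourier coefficients of `Δ^i g` in terms of those of `g`. -/
theorem integral_stdPolyI_mul {m : ℕ} (hmk : m ≤ k) {g : ℤ → ℝ}
    (hg : Summable fun j => diff m g j ^ 2 * wt (quad δ β γ) p m j) {i : ℕ} (hi : i ≤ m) :
    Summable (fun j => stdPolyI p (quad δ β γ) δ (k - i) i j * diff i g j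
      * pmfI p (quad δ β γ) i j) ∧
    ∑' j, stdPolyI p (quad δ β γ) δ (k - i) i j * diff i g j * pmfI p (quad δ β γ) i j
      = coeffV p (quad δ β γ) δ k i * ∑' j, stdPoly p (quad δ β γ) δ k j * g j * p j := by
  set q := quad δ β γ with hq
  have hs := H.summable_backDiff_mul_of_sq hm (m := m) (u := k - m) (by omega) hg
  have hdiff : diff m g = diff (m - i) (diff i g) := by
    rw [diff, diff, diff, ← Function.iterate_add_apply, Nat.sub_add_cancel hi]
  -- The sums for `0` and for `i` are both compared with the one for `m`, so square summability of
  -- the lower differences is not needed.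
  have h0 := H.tsum_backDiff_mul hm le_rfl m (k - m) 0 (by omega) g hs
  have hi' := H.tsum_backDiff_mul hm le_rfl (m - i) (k - m) i (by omega) (diff i g) (hdiff ▸ hs)
  rw [← hdiff, ← h0.2, show k - m + (m - i) = k - i by omega, show k - m + m = k by omega] at hi'
  clear h0 hs
  rw [← hq] at hi'
  have hAi := H.momentA_pos hm hj₀ (i := i) (by omega)
  have hAk := H.momentA_pos hm hj₀ (i := k) le_rfl
  rw [← hq] at hAi hAk
  have hstd (i : ℕ) (hik : i ≤ k) (j : ℤ) := H.stdPolyI_mul_pmfI (i := i) (t := k - i)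
    (H.momentA_pos hm hj₀ hik) (by
      rcases hik.lt_or_eq with h | h
      · exact .inl (H.one_sub_pos_of_lt hm hj₀ h)
      · exact .inr (by omega)) j
  have hp0 : pmfI p q 0 = p := by funext j; simp [pmfI, q, hA0, ascPow]
  have hstd0 := hstd 0 (by omega)
  have hstdi := hstd i (by omega)
  rw [Nat.sub_zero, ← hq, stdPolyI_zero δ k hA0, hp0, hA0, Nat.zero_add, mul_one] at hstd0
  rw [show i + (k - i) = k by omega, ← hq] at hstdi
  have e0 : ∀ j, stdPoly p q δ k j * g j * p j
      = backDiff k (wt q p k) j * g j * (√(k.factorial * leadCoef δ 0 k * momentA p q k))⁻¹ :=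
    fun j => by rw [mul_right_comm, hstd0]; ring
  have ei : ∀ j, stdPolyI p q δ (k - i) i j * diff i g j * pmfI p q i j
      = backDiff (k - i) (wt q p k) j * diff i g j
        * (√((k - i).factorial * leadCoef δ i (k - i) * momentA p q k * momentA p q i))⁻¹ :=
    fun j => by rw [mul_right_comm, hstdi]; ring
  simp only [e0, ei, tsum_mul_right, hi'.2]
  refine ⟨hi'.1.mul_right _, ?_⟩
  have hL0 := H.leadCoef_pos hm hj₀ (i := 0) (t := k) (by omega)
  have hLi := H.leadCoef_pos hm hj₀ (i := i) (t := k - i) (by omega)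
  have hL := leadCoef_zero_mul δ i (k - i)
  rw [show i + (k - i) = k by omega] at hL
  rw [mul_left_comm]
  congr 1
  rw [coeffV, ← Real.sqrt_inv, ← Real.sqrt_inv,
    ← Real.sqrt_mul (div_nonneg (H.weight_nonneg hm hj₀ (by omega)) hAi.le)]
  congr 1
  rw [weight, ← hL]
  rw [← hL] at hL0
  have hprod := (pos_of_mul_pos_left hL0 hLi.le).ne'
  generalize ∏ r ∈ Finset.range i, (1 - ((k : ℝ) - 1 + r) * δ) = c at hprod ⊢
  field_simp

end Level

end OrdSeq

theorem exists_add_le_of_le_encard_sub_one {S : Set ℤ} {k : ℕ} (h : (k : ℕ∞) ≤ S.encard - 1)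
    (hS : S.Nonempty) : ∃ a ∈ S, ∃ b ∈ S, a + k ≤ b := by
  have h1 : ((k + 1 : ℕ) : ℕ∞) ≤ S.encard := by
    have h2 : 1 ≤ S.encard := Set.one_le_encard_iff_nonempty.2 hS
    push_cast
    calc (k : ℕ∞) + 1 ≤ S.encard - 1 + 1 := by gcongr
      _ = S.encard := tsub_add_cancel_of_le h2
  obtain ⟨T, hTS, hT⟩ := Set.exists_subset_encard_eq h1
  have hfin : T.Finite := Set.finite_of_encard_eq_coe hT
  lift T to Finset ℤ using hfin
  rw [Set.encard_coe_eq_coe_finsetCard] at hT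
  have hc : T.card = k + 1 := by exact_mod_cast hT
  have hne : T.Nonempty := Finset.card_pos.1 (by omega)
  refine ⟨T.min' hne, hTS (T.min'_mem hne), T.max' hne, hTS (T.max'_mem hne), ?_⟩
  have hsub : T ⊆ Finset.Icc (T.min' hne) (T.max' hne) := fun x hx =>
    Finset.mem_Icc.2 ⟨T.min'_le x hx, T.le_max' x hx⟩
  have := Finset.card_le_card hsub
  rw [Int.card_Icc] at this
  omega

end CumOrd

/-! ### Determinacy by moments and an abstract Parseval identity -/

namespace CumOrd

open ProbabilityTheory in
/-- Two finite measures on the line with exponential moments and the same moments are equal. -/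
theorem ext_of_moments {μ ν : Measure ℝ} [IsFiniteMeasure μ] [IsFiniteMeasure ν]
    (hμ : 0 ∈ interior (integrableExpSet id μ)) (hν : 0 ∈ interior (integrableExpSet id ν))
    (h : ∀ n : ℕ, ∫ x, x ^ n ∂μ = ∫ x, x ^ n ∂ν) : μ = ν := by
  obtain ⟨r, hr, hball⟩ := Metric.isOpen_iff.1
    (isOpen_interior.inter isOpen_interior (s := interior (integrableExpSet id μ))
      (t := interior (integrableExpSet id ν))) 0 ⟨hμ, hν⟩
  set U : Set ℂ := {z | z.re ∈ Metric.ball (0 : ℝ) r} with hU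
  have hd (z : ℂ) (hz : z ∈ U) : z.re ∈ interior (integrableExpSet id μ) ∧
      z.re ∈ interior (integrableExpSet id ν) := hball hz
  have haμ : AnalyticOnNhd ℂ (complexMGF id μ) U :=
    analyticOnNhd_complexMGF.mono fun z hz => (hd z hz).1
  have haν : AnalyticOnNhd ℂ (complexMGF id ν) U :=
    analyticOnNhd_complexMGF.mono fun z hz => (hd z hz).2
  have hsub : Metric.ball (0 : ℂ) r ⊆ U := fun z hz => by
    simp only [hU, Set.mem_ofPred_eq, Metric.mem_ball, dist_zero_right] at hz ⊢
    exact (Complex.abs_re_le_norm z).trans_lt hz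
  have hder (n : ℕ) : iteratedDeriv n (complexMGF id μ) 0 = iteratedDeriv n (complexMGF id ν) 0 := by
    rw [iteratedDeriv_complexMGF (by simpa using hμ), iteratedDeriv_complexMGF (by simpa using hν)]
    simp only [id_eq, zero_mul, Complex.exp_zero, mul_one, ← Complex.ofReal_pow]
    rw [integral_complex_ofReal, integral_complex_ofReal, h n]
  have hnhds : complexMGF id μ =ᶠ[nhds 0] complexMGF id ν := by
    filter_upwards [Metric.ball_mem_nhds (0 : ℂ) hr] with z hz
    rw [← Complex.taylorSeries_eq_on_ball' hz (haμ.differentiableOn.mono hsub),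
      ← Complex.taylorSeries_eq_on_ball' hz (haν.differentiableOn.mono hsub)]
    simp only [hder]
  -- Equality near zero spreads over the vertical strip `U`, hence to the imaginary axis, where the
  -- complex moment generating function is the characteristic function.
  have hpre : IsPreconnected U :=
    ((convex_ball (0 : ℝ) r).linear_preimage Complex.reLm).isPreconnected
  have heq := haμ.eqOn_of_preconnected_of_eventuallyEq haν hpre (hsub (Metric.mem_ball_self hr)) hnhds
  refine Measure.ext_of_charFun (funext fun t => ?_)
  rw [← complexMGF_id_mul_I, ← complexMGF_id_mul_I]
  exact heq (by simpa [hU] using hr)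

/-- A sequence on `ℤ` with exponential decay, all of whose moments vanish, is zero. -/
theorem eq_zero_of_moments {u : ℤ → ℝ} {ρ : ℝ} (hρ : 0 < ρ)
    (hu : Summable fun j : ℤ => |u j| * Real.exp (ρ * |(j : ℝ)|))
    (h : ∀ n : ℕ, ∑' j : ℤ, u j * (j : ℝ) ^ n = 0) (j : ℤ) : u j = 0 := by
  have hcast : Measurable (fun j : ℤ => (j : ℝ)) := measurable_of_countable _
  have key (v : ℤ → ℝ) (hv0 : ∀ j, 0 ≤ v j) (hv : ∀ j, v j ≤ |u j|) :
      IsFiniteMeasure ((lawOf v).map fun j : ℤ => (j : ℝ)) ∧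
      0 ∈ interior (ProbabilityTheory.integrableExpSet id ((lawOf v).map fun j : ℤ => (j : ℝ))) ∧
      ∀ n : ℕ, ∫ x, x ^ n ∂((lawOf v).map fun j : ℤ => (j : ℝ)) = ∑' j : ℤ, (j : ℝ) ^ n * v j := by
    refine ⟨?_, ?_, fun n => ?_⟩
    · have : Integrable (fun _ : ℤ => (1 : ℝ)) (lawOf v) := by
        rw [integrable_lawOf_iff hv0]
        refine hu.of_nonneg_of_le (fun j => by simpa using hv0 j) fun j => ?_
        rw [one_mul]
        exact (hv j).trans (le_mul_of_one_le_right (abs_nonneg _)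
          (Real.one_le_exp (by positivity)))
      have : IsFiniteMeasure (lawOf v) := (integrable_const_iff.1 this).resolve_left one_ne_zero
      infer_instance
    · rw [mem_interior_iff_mem_nhds]
      filter_upwards [Metric.ball_mem_nhds (0 : ℝ) hρ] with t ht
      change Integrable _ _
      rw [integrable_map_measure (by fun_prop) hcast.aemeasurable]
      change Integrable (fun j : ℤ => Real.exp (t * j)) (lawOf v)
      rw [integrable_lawOf_iff hv0]
      refine hu.of_nonneg_of_le (fun j => mul_nonneg (Real.exp_pos _).le (hv0 j)) fun j => ?_
      rw [mul_comm]
      refine mul_le_mul (hv j) (Real.exp_le_exp.2 ?_) (Real.exp_pos _).le (abs_nonneg _)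
      refine (le_abs_self _).trans ?_
      rw [abs_mul]
      gcongr
      simpa using (Metric.mem_ball.1 ht).le
    · rw [integral_map hcast.aemeasurable (by fun_prop), integral_lawOf hv0]
  -- The positive and negative parts of `u` define two measures; since the moments of `u` vanish,
  -- theirs agree.
  obtain ⟨f1, e1, m1⟩ := key (fun j => max (u j) 0) (fun j => le_max_right _ _)
    (fun j => max_le (le_abs_self _) (abs_nonneg _))
  obtain ⟨f2, e2, m2⟩ := key (fun j => max (-u j) 0) (fun j => le_max_right _ _)
    (fun j => max_le (neg_le_abs _) (abs_nonneg _))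
  have hmom (n : ℕ) (v : ℤ → ℝ) (hv0 : ∀ j, 0 ≤ v j) (hv : ∀ j, v j ≤ |u j|) :
      Summable fun j : ℤ => (j : ℝ) ^ n * v j := by
    refine Summable.of_norm_bounded (hu.mul_left (n.factorial / ρ ^ n)) fun j => ?_
    rw [Real.norm_eq_abs, abs_mul, abs_of_nonneg (hv0 j), abs_pow]
    have h1 := Real.pow_div_factorial_le_exp (x := ρ * |(j : ℝ)|) (by positivity) n
    have h2 : |(j : ℝ)| ^ n ≤ n.factorial / ρ ^ n * Real.exp (ρ * |(j : ℝ)|) := by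
      rw [div_le_iff₀ (by positivity), mul_pow] at h1
      rw [div_mul_eq_mul_div, le_div_iff₀ (by positivity)]
      linarith
    calc |(j : ℝ)| ^ n * v j ≤ n.factorial / ρ ^ n * Real.exp (ρ * |(j : ℝ)|) * |u j| :=
          mul_le_mul h2 (hv j) (hv0 j) (by positivity)
      _ = _ := by ring
  have heq := ext_of_moments e1 e2 fun n => by
    rw [m1, m2, ← sub_eq_zero, ← Summable.tsum_sub
      (hmom n _ (fun j => le_max_right _ _) (fun j => max_le (le_abs_self _) (abs_nonneg _)))
      (hmom n _ (fun j => le_max_right _ _) (fun j => max_le (neg_le_abs _) (abs_nonneg _)))]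
    refine (tsum_congr fun j => ?_).trans (h n)
    rcases le_total (u j) 0 with hj | hj
    · rw [max_eq_right hj, max_eq_left (by linarith)]; ring
    · rw [max_eq_left hj, max_eq_right (by linarith)]; ring
  have hj := congrArg (fun m : Measure ℝ => m {(j : ℝ)}) heq
  have hpre : (fun j : ℤ => (j : ℝ)) ⁻¹' {(j : ℝ)} = {j} := by ext; simp
  simp only [Measure.map_apply hcast (measurableSet_singleton _), hpre, lawOf,
    withDensity_apply _ (measurableSet_singleton j), Measure.restrict_singleton,
    Measure.count_singleton, one_smul, lintegral_dirac] at hj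
  rw [ENNReal.ofReal_eq_ofReal_iff (le_max_right _ _) (le_max_right _ _)] at hj
  rcases le_total (u j) 0 with hj0 | hj0
  · rw [max_eq_right hj0, max_eq_left (by linarith)] at hj; linarith
  · rw [max_eq_left hj0, max_eq_right (by linarith)] at hj; linarith

/-- Parseval's identity for a complete orthonormal system of functions on `ℤ` with respect to a
nonnegative weight. -/
theorem hasSum_sq_of_orthonormal {ι : Type*} {w : ℤ → ℝ} (hw : ∀ j, 0 ≤ w j) {ψ : ι → ℤ → ℝ}
    (hψ : ∀ k, Summable fun j => ψ k j ^ 2 * w j)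
    (hone : ∀ k, ∑' j, ψ k j ^ 2 * w j = 1)
    (horth : ∀ k l, k ≠ l → ∑' j, ψ k j * ψ l j * w j = 0)
    (hcomplete : ∀ f : ℤ → ℝ, (Summable fun j => f j ^ 2 * w j) →
      (∀ k, ∑' j, ψ k j * f j * w j = 0) → ∀ j, f j * w j = 0)
    {f : ℤ → ℝ} (hf : Summable fun j => f j ^ 2 * w j) :
    HasSum (fun k => (∑' j, ψ k j * f j * w j) ^ 2) (∑' j, f j ^ 2 * w j) := by
  have hmem (f : ℤ → ℝ) (hf : Summable fun j => f j ^ 2 * w j) : MemLp f 2 (lawOf w) :=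
    (memLp_two_lawOf_iff hw f).2 hf
  have hinner (f g : Lp ℝ 2 (lawOf w)) : inner ℝ f g = ∑' j, f j * g j * w j := by
    rw [L2.inner_def, ← integral_lawOf hw]
    simp [mul_comm]
  have hcoe (f g : ℤ → ℝ) (hf : MemLp f 2 (lawOf w)) (hg : MemLp g 2 (lawOf w)) :
      inner ℝ (hf.toLp f) (hg.toLp g) = ∑' j, f j * g j * w j := by
    rw [L2.inner_def, ← integral_lawOf hw]
    refine integral_congr_ae ?_
    filter_upwards [hf.coeFn_toLp, hg.coeFn_toLp] with j h1 h2
    simp [h1, h2, mul_comm]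
  set v : ι → Lp ℝ 2 (lawOf w) := fun k => (hmem _ (hψ k)).toLp (ψ k) with hv
  have hvo : Orthonormal ℝ v := by
    refine ⟨fun k => ?_, fun k l hkl => ?_⟩
    · have : inner ℝ (v k) (v k) = (1 : ℝ) := by
        rw [hv, hcoe, ← hone k]
        exact tsum_congr fun j => by ring
      rw [real_inner_self_eq_norm_sq] at this
      exact (pow_eq_one_iff_of_nonneg (norm_nonneg _) two_ne_zero).1 this
    · exact (hcoe _ _ _ _).trans (horth k l hkl)
  have hbot : (Submodule.span ℝ (Set.range v))ᗮ = ⊥ := by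
    refine (Submodule.eq_bot_iff _).2 fun x hx => ?_
    have hx2 : MemLp x 2 (lawOf w) := Lp.memLp x
    have h0 := hcomplete x ((memLp_two_lawOf_iff hw _).1 hx2) fun k => by
      have := (Submodule.mem_orthogonal _ _).1 hx (v k) (Submodule.subset_span ⟨k, rfl⟩)
      rw [← Lp.toLp_coeFn x hx2, hv, hcoe] at this
      exact this
    have : inner ℝ x x = (0 : ℝ) := by
      rw [hinner]
      simp only [mul_assoc, h0, mul_zero, tsum_zero]
    exact inner_self_eq_zero.1 this
  have := (HilbertBasis.mkOfOrthogonalEqBot hvo hbot).hasSum_inner_mul_inner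
    ((hmem f hf).toLp f) ((hmem f hf).toLp f)
  rw [HilbertBasis.coe_mkOfOrthogonalEqBot, hcoe] at this
  simp only [← sq] at this
  exact this.congr_fun fun k => by rw [real_inner_comm, hv, hcoe, sq]

end CumOrd

/-! ### Exponential tails, a Poincaré inequality and completeness of monomials -/

namespace CumOrd

theorem summable_pow_mul_exp_mul {p : ℤ → ℝ} (hp : ∀ j, 0 ≤ p j) {ρ σ : ℝ} (hρ : σ < ρ)
    (h : Summable fun j : ℤ => Real.exp (ρ * |(j : ℝ)|) * p j) (N : ℕ) :
    Summable fun j : ℤ => (1 + |(j : ℝ)|) ^ N * (Real.exp (σ * |(j : ℝ)|) * p j) := by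
  have hd : 0 < ρ - σ := sub_pos.2 hρ
  refine (h.mul_left (N.factorial / (ρ - σ) ^ N * Real.exp (ρ - σ))).of_nonneg_of_le
    (fun j => mul_nonneg (by positivity) (mul_nonneg (Real.exp_pos _).le (hp j))) fun j => ?_
  have h1 := Real.pow_div_factorial_le_exp (x := (ρ - σ) * (1 + |(j : ℝ)|)) (by positivity) N
  rw [div_le_iff₀ (by positivity), mul_pow] at h1
  have h2 : (1 + |(j : ℝ)|) ^ N
      ≤ N.factorial / (ρ - σ) ^ N * Real.exp ((ρ - σ) * (1 + |(j : ℝ)|)) := by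
    rw [div_mul_eq_mul_div, le_div_iff₀ (by positivity)]
    linarith
  have h3 : Real.exp ((ρ - σ) * (1 + |(j : ℝ)|)) * Real.exp (σ * |(j : ℝ)|)
      = Real.exp (ρ - σ) * Real.exp (ρ * |(j : ℝ)|) := by
    rw [← Real.exp_add, ← Real.exp_add]
    ring_nf
  calc (1 + |(j : ℝ)|) ^ N * (Real.exp (σ * |(j : ℝ)|) * p j)
      ≤ N.factorial / (ρ - σ) ^ N * Real.exp ((ρ - σ) * (1 + |(j : ℝ)|))
        * (Real.exp (σ * |(j : ℝ)|) * p j) :=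
        mul_le_mul_of_nonneg_right h2 (mul_nonneg (Real.exp_pos _).le (hp j))
    _ = N.factorial / (ρ - σ) ^ N * (Real.exp ((ρ - σ) * (1 + |(j : ℝ)|))
        * Real.exp (σ * |(j : ℝ)|)) * p j := by ring
    _ = _ := by rw [h3]; ring

theorem summable_int_of_geometric {f : ℤ → ℝ} (hf : ∀ j, 0 ≤ f j) {r C : ℝ} (hr0 : 0 ≤ r)
    (hr : r < 1) (N : ℕ) (h1 : ∀ n : ℕ, f (n + N) ≤ C * r ^ n)
    (h2 : ∀ n : ℕ, f (-(n + N)) ≤ C * r ^ n) : Summable f := by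
  have hg := (summable_geometric_of_lt_one hr0 hr).mul_left C
  refine Summable.of_nat_of_neg ?_ ?_
  · rw [← summable_nat_add_iff N]
    exact hg.of_nonneg_of_le (fun n => hf _) fun n => by simpa using h1 n
  · rw [← summable_nat_add_iff N]
    exact hg.of_nonneg_of_le (fun n => hf _) fun n => by simpa using h2 n

namespace OrdSeq

variable {p : ℤ → ℝ} {μ δ β γ : ℝ} (H : OrdSeq p μ δ β γ)

include H

/-- For `δ ≤ 0`, `q(j) ≤ K |j - μ|` away from the mean, so the flux `q p` is at most `K` times the
size of its own increment and decays geometrically in both directions. The mass `p` is bounded by a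
neighbouring flux. -/
theorem exists_summable_exp (hδ : δ ≤ 0) :
    ∃ ρ > 0, Summable fun j : ℤ => Real.exp (ρ * |(j : ℝ)|) * p j := by
  set q := quad δ β γ with hq
  set K : ℝ := |β| + |β| * |μ| + |γ| + 1 with hK
  have hK1 : 1 ≤ K := by
    have := mul_nonneg (abs_nonneg β) (abs_nonneg μ)
    linarith [abs_nonneg β, abs_nonneg γ]
  have hqK (j : ℤ) (hj : 1 ≤ |(j : ℝ) - μ|) : q j ≤ K * |(j : ℝ) - μ| := by
    have h1 : q j ≤ |β| * |(j : ℝ)| + |γ| := by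
      rw [hq, quad, ← abs_mul]
      nlinarith [le_abs_self (β * j), le_abs_self γ, mul_nonneg (neg_nonneg.2 hδ) (sq_nonneg (j : ℝ))]
    have h2 : |(j : ℝ)| ≤ |(j : ℝ) - μ| + |μ| := by
      simpa using abs_add_le ((j : ℝ) - μ) μ
    have h3 := mul_le_mul_of_nonneg_left h2 (abs_nonneg β)
    have h4 := mul_nonneg (abs_nonneg β) (abs_nonneg μ)
    nlinarith [abs_nonneg γ]
  set θ : ℝ := K / (1 + K) with hθ
  have hθ0 : 0 < θ := by positivity
  have hθ1 : θ < 1 := by rw [hθ, div_lt_one (by positivity)]; linarith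
  have hright (j : ℤ) (hj : μ + 1 ≤ j) :
      q j * p j ≤ θ * (q (j - 1) * p (j - 1)) ∧ p j ≤ q (j - 1) * p (j - 1) := by
    have ha : |(j : ℝ) - μ| = j - μ := abs_of_nonneg (by linarith)
    have h1 := mul_le_mul_of_nonneg_right (hqK j (by rw [ha]; linarith)) (H.nonneg j)
    rw [ha] at h1
    have h2 := H.rec_eq j
    rw [← hq] at h2
    have h3 := H.flux_nonneg j
    rw [← hq] at h3
    constructor
    · rw [hθ, div_mul_eq_mul_div, le_div_iff₀ (by positivity)]
      linear_combination h1 + K * h2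
    · nlinarith [H.nonneg j]
  have hleft (j : ℤ) (hj : (j : ℝ) ≤ μ - 1) :
      q (j - 1) * p (j - 1) ≤ θ * (q j * p j) ∧ p j ≤ q j * p j := by
    have ha : |(j : ℝ) - μ| = μ - j := by rw [abs_of_nonpos (by linarith)]; ring
    have h1 := mul_le_mul_of_nonneg_right (hqK j (by rw [ha]; linarith)) (H.nonneg j)
    rw [ha] at h1
    have h2 := H.rec_eq j
    rw [← hq] at h2
    have h3 := H.flux_nonneg j
    have h4 := H.flux_nonneg (j - 1)
    rw [← hq] at h3 h4
    constructor
    · rw [hθ, div_mul_eq_mul_div, le_div_iff₀ (by positivity)]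
      -- On this side the ratio is `(K - 1) / K`, which is at most `θ = K / (1 + K)` since `(K -
      -- 1)(K + 1) ≤ K²`.
      have h5 : K * (q (j - 1) * p (j - 1)) ≤ (K - 1) * (q j * p j) := by
        linear_combination h1 - K * h2
      have h6 : K * ((1 + K) * (q (j - 1) * p (j - 1))) ≤ K * (K * (q j * p j)) := by
        nlinarith
      have := le_of_mul_le_mul_left h6 (by linarith)
      linarith
    · nlinarith [H.nonneg j]
  obtain ⟨N, hN⟩ := exists_nat_ge (|μ| + 1)
  have hNμ := abs_le.1 (by linarith : |μ| ≤ N - 1)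
  have hR (n : ℕ) : q (N + n) * p (N + n) ≤ θ ^ n * (q N * p N) := by
    induction n with
    | zero => simp
    | succ n ih =>
      have := (hright (N + (n + 1 : ℕ)) (by push_cast; linarith [n.cast_nonneg (α := ℝ)])).1
      rw [show (N : ℤ) + (n + 1 : ℕ) - 1 = N + n by push_cast; ring] at this
      refine this.trans ?_
      rw [pow_succ', mul_assoc]
      exact mul_le_mul_of_nonneg_left ih hθ0.le
  have hL (n : ℕ) : q (-N - n) * p (-N - n) ≤ θ ^ n * (q (-N) * p (-N)) := by
    induction n with
    | zero => simp
    | succ n ih =>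
      have := (hleft (-N - n) (by push_cast; linarith [n.cast_nonneg (α := ℝ)])).1
      rw [show -(N : ℤ) - n - 1 = -N - (n + 1 : ℕ) by push_cast; ring] at this
      refine this.trans ?_
      rw [pow_succ', mul_assoc]
      exact mul_le_mul_of_nonneg_left ih hθ0.le
  -- The midpoint of `1` and `θ⁻¹`: then `s > 1` and `s θ < 1`, so `log s` is an admissible rate.
  set s : ℝ := (1 + θ⁻¹) / 2 with hs
  have hθi : 1 < θ⁻¹ := (one_lt_inv₀ hθ0).2 hθ1
  have hs1 : 1 < s := by rw [hs]; linarith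
  have hsθ : s * θ < 1 := by
    have : s * θ = (θ + 1) / 2 := by rw [hs]; field_simp
    linarith
  have hexp (m : ℕ) : Real.exp (Real.log s * m) = s ^ m := by
    rw [mul_comm, Real.exp_nat_mul, Real.exp_log (by linarith)]
  have hs0 : 0 ≤ s := by linarith
  have hQ := H.flux_nonneg N
  have hQ' := H.flux_nonneg (-N)
  rw [← hq] at hQ hQ'
  set Q := q N * p N + q (-N) * p (-N) with hQdef
  clear_value Q s θ
  refine ⟨Real.log s, Real.log_pos hs1, ?_⟩
  refine summable_int_of_geometric (fun j => mul_nonneg (Real.exp_pos _).le (H.nonneg j))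
    (C := s ^ (N + 1) * Q) (r := s * θ)
    (by positivity) hsθ (N + 1) (fun n => ?_) (fun n => ?_)
  · have h1 : |(((n : ℤ) + (N + 1 : ℕ) : ℤ) : ℝ)| = ((n + (N + 1) : ℕ) : ℝ) := by
      push_cast
      exact abs_of_nonneg (by positivity)
    have h2 : p (n + (N + 1 : ℕ)) ≤ θ ^ n * Q := by
      have h3 := (hright (n + (N + 1 : ℕ)) (by push_cast; linarith [n.cast_nonneg (α := ℝ)])).2
      rw [show (n : ℤ) + (N + 1 : ℕ) - 1 = N + n by push_cast; ring] at h3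
      refine (h3.trans (hR n)).trans (mul_le_mul_of_nonneg_left ?_ (by positivity))
      linarith
    rw [h1, hexp]
    calc s ^ (n + (N + 1)) * p (n + (N + 1 : ℕ))
        ≤ s ^ (n + (N + 1)) * (θ ^ n * Q) := by gcongr
      _ = _ := by ring
  · have h1 : |((-((n : ℤ) + (N + 1 : ℕ)) : ℤ) : ℝ)| = ((n + (N + 1) : ℕ) : ℝ) := by
      push_cast
      rw [abs_neg]
      exact abs_of_nonneg (by positivity)
    have h2 : p (-(n + (N + 1 : ℕ))) ≤ θ ^ n * Q := by
      have h3 := (hleft (-(n + (N + 1 : ℕ))) (by push_cast; linarith [n.cast_nonneg (α := ℝ)])).2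
      rw [show -((n : ℤ) + (N + 1 : ℕ)) = -N - (n + 1 : ℕ) by push_cast; ring] at h3 ⊢
      refine (h3.trans (hL (n + 1))).trans ?_
      calc θ ^ (n + 1) * (q (-N) * p (-N)) ≤ θ ^ n * (q (-N) * p (-N)) :=
            mul_le_mul_of_nonneg_right
              (pow_le_pow_of_le_one hθ0.le hθ1.le n.le_succ) hQ'
        _ ≤ _ := mul_le_mul_of_nonneg_left (by linarith) (by positivity)
    rw [h1, hexp]
    calc s ^ (n + (N + 1)) * p (-(n + (N + 1 : ℕ)))
        ≤ s ^ (n + (N + 1)) * (θ ^ n * Q) := by gcongr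
      _ = _ := by ring

/-- A Poincaré type inequality: square summability of the difference of `h` with respect to one
weight gives square summability of `h` with respect to the preceding weight. -/
theorem summable_sq_of_fwdDiff {i N : ℕ}
    (hm : Summable fun j : ℤ => (1 + |(j : ℝ)|) ^ N * p j) (hN : 2 * i + 2 ≤ N)
    (hd : 0 < 1 - 2 * i * δ) (h : ℤ → ℝ)
    (hs : Summable fun j => (h (j + 1) - h j) ^ 2 * wt (quad δ β γ) p (i + 1) j) :
    Summable fun j => h j ^ 2 * wt (quad δ β γ) p i j := by
  set d := 1 - 2 * i * δ with hd'
  set c := δ * i ^ 2 + β * i + μ with hc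
  set B : ℤ → ℝ := fun j => (d * j - c) * wt (quad δ β γ) p i j with hBdef
  have hw := H.wt_nonneg i
  have hBC (j : ℤ) : B j
      = wt (quad δ β γ) p (i + 1) (j - 1) - wt (quad δ β γ) p (i + 1) j := by
    have h1 := H.wt_succ_sub i j
    have h2 : quad δ β γ (j + i) - quad δ β γ j + μ - j = -(d * j - c) := by
      simp only [quad, hd', hc]
      push_cast
      ring
    rw [h2] at h1
    simp only [hBdef]
    linarith
  have hlead : HasLead 1 d (fun j : ℤ => d * j - c) :=
    ((HasLead.cast.const_mul d).sub ((HasLead.const c).of_lt one_pos)).congr (fun _ => rfl) (by ring)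
  have hB : Summable B := H.summable_mul_wt hm hlead (by omega)
  have hC := H.summable_wt hm (i := i + 1) (by omega)
  have hx : Summable fun x : ℤ => (x : ℝ) * wt (quad δ β γ) p i x :=
    H.summable_mul_wt hm HasLead.cast (by omega)
  have hx' : Summable fun x : ℤ => |(x : ℝ)| * wt (quad δ β γ) p i x :=
    hx.abs.congr fun x => by rw [abs_mul, abs_of_nonneg (hw x)]
  refine summable_sq_of_summable_fwdDiff_sq hw hx' (H.summable_wt hm (by omega))
    (C := fun y => 2 / d * wt (quad δ β γ) p (i + 1) y) ?_ h
    ((hs.mul_left (2 / d)).congr fun j => by ring)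
  have htail := eventually_tsum_abs_mul_stepKer hBC hB (tendsto_zero_atTop_of_summable hC)
    (tendsto_zero_atBot_of_summable hC)
    (hlead.eventually_sign_atTop.imp
      (fun h => h.mono fun j hj => mul_nonneg hj (hw j))
      (fun h => h.mono fun j hj => mul_nonpos_of_nonpos_of_nonneg hj (hw j)))
    (hlead.eventually_sign_atBot.imp
      (fun h => h.mono fun j hj => mul_nonneg hj (hw j))
      (fun h => h.mono fun j hj => mul_nonpos_of_nonpos_of_nonneg hj (hw j)))
  -- The kernel at `y` involves only `|x| ≥ |y|`, and `|x| ≥ 2|c|/d` gives `|x| ≤ (2/d) |d x - c|`.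
  -- Hence the tails of `|x| w_i` are at most `2/d` times those of `|B|`, which equal `w_{i+1}(y)`.
  have hfar : ∀ᶠ y : ℤ in Filter.cofinite, 2 * |c| / d ≤ |(y : ℝ)| := by
    rw [Int.cofinite_eq, Filter.eventually_sup]
    exact ⟨(Filter.tendsto_abs_atBot_atTop.comp
        (tendsto_intCast_atBot_iff.2 Filter.tendsto_id)).eventually_ge_atTop _,
      (Filter.tendsto_abs_atTop_atTop.comp tendsto_intCast_atTop_atTop).eventually_ge_atTop _⟩
  filter_upwards [htail, hfar] with y hy hy2
  have hk (x : ℤ) (hxy : stepKer x y ≠ 0) : |(y : ℝ)| ≤ |(x : ℝ)| := by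
    have : |y| ≤ |x| := by
      unfold stepKer at hxy
      split_ifs at hxy with h1 h2
      · rw [abs_of_nonneg h1.1, abs_of_nonneg (h1.1.trans h1.2.le)]; exact h1.2.le
      · rw [abs_of_neg h2.2, abs_of_neg (h2.1.trans_lt h2.2)]; omega
      · simp at hxy
    exact_mod_cast this
  rw [abs_of_nonneg (H.wt_nonneg (i + 1) y)] at hy
  rw [← hy, ← tsum_mul_left]
  have hs1 (f : ℤ → ℝ) (hf : Summable f) (hf0 : ∀ x, 0 ≤ f x) :
      Summable fun x => f x * |stepKer x y| :=
    hf.of_nonneg_of_le (fun x => mul_nonneg (hf0 x) (abs_nonneg _))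
      (fun x => mul_le_of_le_one_right (hf0 x) (abs_stepKer_le_one x y))
  refine Summable.tsum_le_tsum (fun x => ?_)
    (hs1 _ hx' fun x => mul_nonneg (abs_nonneg _) (hw x))
    ((hs1 _ hB.abs fun x => abs_nonneg _).mul_left _)
  by_cases hxy : stepKer x y = 0
  · simp [hxy]
  rw [← mul_assoc]
  refine mul_le_mul_of_nonneg_right ?_ (abs_nonneg _)
  simp only [hBdef]
  rw [abs_mul, abs_of_nonneg (hw x), ← mul_assoc]
  refine mul_le_mul_of_nonneg_right ?_ (hw x)
  have h1 := hy2.trans (hk x hxy)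
  rw [div_le_iff₀ hd] at h1
  rw [div_mul_eq_mul_div, le_div_iff₀ hd]
  have h2 : d * |(x : ℝ)| ≤ |d * x - c| + |c| := by
    have := abs_add_le (d * x - c) c
    rwa [sub_add_cancel, abs_mul, abs_of_pos hd] at this
  linarith

theorem summable_diff_sq {n : ℕ} (hm : Summable fun j : ℤ => (1 + |(j : ℝ)|) ^ (2 * n) * p j)
    {j₀ : ℤ} (hj₀ : 0 < wt (quad δ β γ) p n j₀) {g : ℤ → ℝ}
    (hg : Summable fun j => diff n g j ^ 2 * wt (quad δ β γ) p n j) {i : ℕ} (hi : i ≤ n) :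
    Summable fun j => diff i g j ^ 2 * wt (quad δ β γ) p i j := by
  induction hi using Nat.decreasingInduction with
  | self => exact hg
  | of_succ i hi ih =>
    refine H.summable_sq_of_fwdDiff hm (by omega) (H.one_sub_pos_of_lt hm hj₀ hi) _ ?_
    simpa only [diff, Function.iterate_succ', Function.comp_apply, fwdDiff] using ih

/-- Polynomials are complete with respect to weights with exponential decay. -/
theorem eq_zero_of_forall_pow {ρ : ℝ} (hρ : 0 < ρ)
    (hexp : Summable fun j : ℤ => Real.exp (ρ * |(j : ℝ)|) * p j) (i : ℕ) {h : ℤ → ℝ}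
    (hh : Summable fun j => h j ^ 2 * wt (quad δ β γ) p i j)
    (h0 : ∀ n : ℕ, ∑' j : ℤ, h j * wt (quad δ β γ) p i j * (j : ℝ) ^ n = 0) (j : ℤ) :
    h j * wt (quad δ β γ) p i j = 0 := by
  have hw := H.wt_nonneg i
  obtain ⟨K, hK, hb⟩ := ((HasLead.quad δ β γ).ascPow i).exists_bound
  -- Half of the rate pays for the polynomial `q^{[i]}`; halving again pays for bounding `|h|` times
  -- an exponential by a sum of squares.
  have h1 := summable_pow_mul_exp_mul H.nonneg (half_lt_self hρ) hexp (2 * i)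
  have h2 : Summable fun j : ℤ => Real.exp (ρ / 2 * |(j : ℝ)|) * wt (quad δ β γ) p i j := by
    refine (h1.mul_left K).of_nonneg_of_le (fun j => mul_nonneg (Real.exp_pos _).le (hw j))
      fun j => ?_
    have h3 := mul_le_mul_of_nonneg_right ((le_abs_self _).trans (hb j))
      (mul_nonneg (Real.exp_pos (ρ / 2 * |(j : ℝ)|)).le (H.nonneg j))
    rw [wt]
    linarith
  refine eq_zero_of_moments (u := fun j => h j * wt (quad δ β γ) p i j) (ρ := ρ / 4)
    (by positivity) ?_ h0 j
  refine (hh.add h2).of_nonneg_of_le (fun j => by positivity) fun j => ?_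
  rw [abs_mul, abs_of_nonneg (hw j), mul_right_comm, ← add_mul]
  refine mul_le_mul_of_nonneg_right ?_ (hw j)
  have e : Real.exp (ρ / 2 * |(j : ℝ)|) = Real.exp (ρ / 4 * |(j : ℝ)|) ^ 2 := by
    rw [← Real.exp_nat_mul]
    push_cast
    ring_nf
  rw [e, ← sq_abs (h j)]
  nlinarith [sq_nonneg (|h j| - Real.exp (ρ / 4 * |(j : ℝ)|)), sq_nonneg |h j|,
    sq_nonneg (Real.exp (ρ / 4 * |(j : ℝ)|))]

end OrdSeq

end CumOrd

/-! ### Completeness of the orthogonal polynomials and Parseval's identity -/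

namespace CumOrd

namespace OrdSeq

variable {p : ℤ → ℝ} {μ δ β γ : ℝ} (H : OrdSeq p μ δ β γ)

include H

/-- Positive leading coefficients give `F t` the exact degree `t`, so subtracting a multiple of the
top one lowers the degree of `P`. -/
theorem tsum_mul_polynomial_eq_zero
    (hmom : ∀ N : ℕ, Summable fun j : ℤ => (1 + |(j : ℝ)|) ^ N * p j) {i : ℕ} {h : ℤ → ℝ}
    (hh : Summable fun j => h j ^ 2 * wt (quad δ β γ) p i j)
    {F : ℕ → ℤ → ℝ} (hF : ∀ t, HasLead t (leadCoef δ i t) (F t)) {n : ℕ}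
    (hlev : ∀ t < n, 0 < leadCoef δ i t)
    (h0 : ∀ t < n, ∑' j, F t j * h j * wt (quad δ β γ) p i j = 0) (P : Polynomial ℝ)
    (hP : P.degree < n) :
    ∑' j : ℤ, h j * wt (quad δ β γ) p i j * P.eval (j : ℝ) = 0 := by
  have hw := H.wt_nonneg i
  have hsum {f : ℤ → ℝ} {m : ℕ} {c : ℝ} (hf : HasLead m c f) :
      Summable fun j => h j * wt (quad δ β γ) p i j * f j := by
    have h1 := H.summable_mul_wt (hmom (m + m + 2 * i)) (hf.mul hf) le_rfl
    refine Summable.of_norm_bounded (h1.add hh) fun j => ?_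
    rw [Real.norm_eq_abs, mul_right_comm, abs_mul, abs_of_nonneg (hw j), ← add_mul]
    refine mul_le_mul_of_nonneg_right ?_ (hw j)
    rw [abs_mul]
    nlinarith [sq_nonneg (|f j| - |h j|), sq_abs (f j), sq_abs (h j)]
  induction n generalizing P with
  | zero =>
    have : P = 0 := by simpa using hP
    simp [this]
  | succ n ih =>
    obtain ⟨A, hA, hAc, hAF⟩ := hF n
    have hL := hlev n n.lt_succ_self
    set c := P.coeff n / leadCoef δ i n with hc
    have hdeg : (P - Polynomial.C c * A).degree < n := by
      rw [Polynomial.degree_lt_iff_coeff_zero]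
      intro m hm
      rw [Polynomial.coeff_sub, Polynomial.coeff_C_mul]
      rcases hm.lt_or_eq with hm | rfl
      · rw [Polynomial.coeff_eq_zero_of_degree_lt (hP.trans_le (by exact_mod_cast hm)),
          Polynomial.coeff_eq_zero_of_natDegree_lt (hA.trans_lt hm)]
        simp
      · rw [hAc, hc, div_mul_cancel₀ _ hL.ne', sub_self]
    have h1 := ih (fun t ht => hlev t (by omega)) (fun t ht => h0 t (by omega)) _ hdeg
    have h2 := h0 n n.lt_succ_self
    have hs1 : Summable fun j : ℤ => h j * wt (quad δ β γ) p i j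
        * (P - Polynomial.C c * A).eval (j : ℝ) :=
      hsum ⟨_, le_rfl, rfl, fun _ => rfl⟩
    have hs2 : Summable fun j : ℤ => h j * wt (quad δ β γ) p i j * F n j := hsum (hF n)
    have e (j : ℤ) : h j * wt (quad δ β γ) p i j * P.eval (j : ℝ)
        = h j * wt (quad δ β γ) p i j * (P - Polynomial.C c * A).eval (j : ℝ)
          + h j * wt (quad δ β γ) p i j * F n j * c := by
      rw [hAF]
      simp
      ring
    rw [tsum_congr e, hs1.tsum_add (hs2.mul_right c), h1, tsum_mul_right, zero_add]
    convert zero_mul c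
    rw [← h2]
    exact tsum_congr fun j => by ring

/-- The polynomials orthogonal with respect to `q^{[i]} p` are complete. -/
theorem eq_zero_of_orthogonal {ρ : ℝ} (hρ : 0 < ρ)
    (hexp : Summable fun j : ℤ => Real.exp (ρ * |(j : ℝ)|) * p j) {i : ℕ} {h : ℤ → ℝ}
    (hh : Summable fun j => h j ^ 2 * wt (quad δ β γ) p i j)
    {F : ℕ → ℤ → ℝ} (hF : ∀ t, HasLead t (leadCoef δ i t) (F t))
    (h0 : ∀ t, (∃ j, 0 < wt (quad δ β γ) p (i + t) j) →
      ∑' j, F t j * h j * wt (quad δ β γ) p i j = 0) (x : ℤ) :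
    h x * wt (quad δ β γ) p i x = 0 := by
  have hmom (N : ℕ) : Summable fun j : ℤ => (1 + |(j : ℝ)|) ^ N * p j := by
    simpa using summable_pow_mul_exp_mul H.nonneg hρ hexp N
  have hlev (t : ℕ) (ht : ∃ j, 0 < wt (quad δ β γ) p (i + t) j) : 0 < leadCoef δ i t := by
    obtain ⟨j, hj⟩ := ht
    exact H.leadCoef_pos (hmom _) hj le_rfl
  by_cases hall : ∀ t, ∃ j, 0 < wt (quad δ β γ) p (i + t) j
  · refine H.eq_zero_of_forall_pow hρ hexp i hh (fun n => ?_) x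
    simpa using H.tsum_mul_polynomial_eq_zero hmom hh hF (n := n + 1)
      (fun t _ => hlev t (hall t)) (fun t _ => h0 t (hall t)) (Polynomial.X ^ n)
      (by rw [Polynomial.degree_X_pow]; exact_mod_cast n.lt_succ_self)
  · classical
    have hall := not_forall.1 hall
    -- At the first level where `w_{i+n}` vanishes identically, two points of the support of `w_i`
    -- are less than `n` apart: a larger distance would make `w_{i+n}` positive somewhere.
    set n := Nat.find hall with hn
    have hlow (t : ℕ) (ht : t < n) := not_not.1 (Nat.find_min hall ht)
    have hdiam (a b : ℤ) (ha : 0 < wt (quad δ β γ) p i a) (hb : 0 < wt (quad δ β γ) p i b) :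
        b < a + n := by
      by_contra! hab
      obtain ⟨s, hs⟩ := Int.le.dest (sub_nonneg.2 ((le_add_of_nonneg_right
        (Int.natCast_nonneg n)).trans hab))
      have h1 : 0 < wt (quad δ β γ) p (i + s) a :=
        H.wt_pos ((H.wt_nonneg_and i a).2 ha).1 (by
          have := ((H.wt_nonneg_and i b).2 hb).2
          convert this using 1
          push_cast
          congr 1
          omega)
      exact Nat.find_spec hall ⟨a, H.wt_pos_of_le h1 (by omega)⟩
    by_cases hx : wt (quad δ β γ) p i x = 0
    · rw [hx, mul_zero]
    have hx := (H.wt_nonneg i x).lt_of_ne' hx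
    have hn0 : 0 < n := by have := hdiam x x hx hx; omega
    obtain ⟨T, hxT, hTn, hT⟩ : ∃ T : Finset ℤ, x ∈ T ∧ T.card ≤ n ∧
        ∀ y, 0 < wt (quad δ β γ) p i y → y ∈ T := by
      set T := (Finset.Ioo (x - n) (x + n)).filter fun y => 0 < wt (quad δ β γ) p i y with hTdef
      have hmem (y : ℤ) (hy : 0 < wt (quad δ β γ) p i y) : y ∈ T := by
        have h1 := hdiam x y hx hy
        have h2 := hdiam y x hy hx
        rw [hTdef, Finset.mem_filter, Finset.mem_Ioo]
        exact ⟨⟨by omega, h1⟩, hy⟩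
      refine ⟨T, hmem x hx, ?_, hmem⟩
      have hne : T.Nonempty := ⟨x, hmem x hx⟩
      have hsub : T ⊆ Finset.Ico (T.min' hne) (T.min' hne + n) := fun y hy =>
        Finset.mem_Ico.2 ⟨T.min'_le y hy, hdiam _ _
          (Finset.mem_filter.1 (T.min'_mem hne)).2 (Finset.mem_filter.1 hy).2⟩
      simpa using Finset.card_le_card hsub
    -- The Lagrange interpolation polynomial at `x`, unnormalized: on at most `n` points its degree
    -- is below `n`, and it isolates the term at `x`.
    set Q : Polynomial ℝ := ∏ y ∈ T.erase x, (Polynomial.X - Polynomial.C (y : ℝ)) with hQ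
    have hQdeg : Q.degree < n := by
      rw [hQ, Polynomial.degree_prod]
      simp only [Polynomial.degree_X_sub_C, Finset.sum_const, Finset.card_erase_of_mem hxT]
      rw [nsmul_one]
      have : T.card - 1 < n := by have := Finset.card_pos.2 ⟨x, hxT⟩; omega
      exact_mod_cast this
    have h1 := H.tsum_mul_polynomial_eq_zero hmom hh hF (fun t ht => hlev t (hlow t ht))
      (fun t ht => h0 t (hlow t ht)) Q hQdeg
    rw [tsum_eq_single x] at h1
    · refine (mul_eq_zero.1 h1).resolve_right ?_
      rw [hQ, Polynomial.eval_prod]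
      refine Finset.prod_ne_zero_iff.2 fun y hy => ?_
      have : (x : ℝ) ≠ y := by exact_mod_cast (Finset.ne_of_mem_erase hy).symm
      simpa [sub_eq_zero] using this
    · intro y hy
      by_cases hy0 : wt (quad δ β γ) p i y = 0
      · rw [hy0, mul_zero, zero_mul]
      · have hyT := hT y ((H.wt_nonneg i y).lt_of_ne' hy0)
        rw [hQ, Polynomial.eval_prod, Finset.prod_eq_zero (Finset.mem_erase.2 ⟨hy, hyT⟩) (by simp),
          mul_zero]

/-- Parseval's identity for the polynomials orthogonal with respect to `q^{[i]} p`. -/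
theorem hasSum_parseval {ρ : ℝ} (hρ : 0 < ρ)
    (hexp : Summable fun j : ℤ => Real.exp (ρ * |(j : ℝ)|) * p j) (i : ℕ) {h : ℤ → ℝ}
    (hh : Summable fun j => h j ^ 2 * wt (quad δ β γ) p i j) :
    HasSum (fun t : {t : ℕ // ∃ j, 0 < wt (quad δ β γ) p (i + t) j} =>
        (∑' j, backDiff t (wt (quad δ β γ) p (i + t)) j * h j) ^ 2 /
          ((t : ℕ).factorial * leadCoef δ i t * momentA p (quad δ β γ) (i + t)))
      (∑' j, h j ^ 2 * wt (quad δ β γ) p i j) := by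
  set q := quad δ β γ with hq
  have hmom (N : ℕ) : Summable fun j : ℤ => (1 + |(j : ℝ)|) ^ N * p j := by
    simpa using summable_pow_mul_exp_mul H.nonneg hρ hexp N
  choose F hF hFw using fun t => H.exists_backDiff_wt t i
  rw [← hq] at hFw
  set ι := {t : ℕ // ∃ j, 0 < wt q p (i + t) j}
  set c : ℕ → ℝ := fun t => t.factorial * leadCoef δ i t * momentA p q (i + t) with hc
  have hcpos (t : ι) : 0 < c t := by
    obtain ⟨t, j, hj⟩ := t
    have h1 := H.leadCoef_pos (hmom _) hj le_rfl
    have h2 := H.momentA_pos (hmom _) hj le_rfl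
    rw [← hq] at h2
    simp only [hc]
    positivity
  -- All `t` differences are moved onto `F s`, whose `t`-th difference is the constant `t! d`. The
  -- choice `s = t` gives the norms; `s < t`, where `d = 0`, gives orthogonality.
  have hdual (s t : ℕ) (d : ℝ) (hd : HasLead t d (F s)) :
      ∑' j, F t j * F s j * wt q p i j = t.factorial * d * momentA p q (i + t) := by
    have h1 := H.tsum_backDiff_mul (hmom _) le_rfl t 0 i (k := i + t) rfl (F s) (by
      simp only [backDiff, hd.fwdDiff_iter]
      exact (H.summable_wt (hmom _) le_rfl).mul_right _)
    have h2 := h1.2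
    simp only [backDiff, hd.fwdDiff_iter, tsum_mul_right, zero_add] at h2
    rw [momentA_eq H.nonneg, mul_comm, ← h2]
    exact tsum_congr fun j => by rw [hFw]; ring
  have hnorm (t : ℕ) : ∑' j, F t j * F t j * wt q p i j = c t := hdual t t _ (hF t)
  have horth (s t : ℕ) (hst : s < t) : ∑' j, F t j * F s j * wt q p i j = 0 := by
    rw [hdual s t 0 ((hF s).of_lt hst)]
    ring
  have hψ (t : ι) (j : ℤ) : (F t j / √(c t)) ^ 2 = F t j * F t j / c t := by
    rw [div_pow, Real.sq_sqrt (hcpos t).le, sq]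
  have key := hasSum_sq_of_orthonormal (H.wt_nonneg i) (ψ := fun (t : ι) j => F t j / √(c t))
    (fun t => by
      simp only [hψ]
      refine ((H.summable_mul_wt (i := i) (hmom _) ((hF t).mul (hF t)) le_rfl).div_const (c t)).congr
        fun j => ?_
      ring)
    (fun t => by
      rw [← div_self (hcpos t).ne', ← hnorm t, ← tsum_div_const, hnorm t]
      refine tsum_congr fun j => ?_
      rw [hψ, ← hq]
      ring)
    (fun s t hst => by
      have e (j : ℤ) : F s j / √(c s) * (F t j / √(c t)) * wt q p i j
          = F s j * F t j * wt q p i j / (√(c s) * √(c t)) := by ring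
      rw [tsum_congr e, tsum_div_const]
      rcases lt_or_gt_of_ne (Subtype.coe_ne_coe.2 hst) with h | h
      · have h2 := horth s t h
        rw [tsum_congr fun j => by rw [mul_comm (F t j)]] at h2
        rw [h2, zero_div]
      · rw [horth t s h, zero_div])
    (fun f hf hf0 => H.eq_zero_of_orthogonal hρ hexp hf hF fun t ht => by
      have h1 := hf0 ⟨t, ht⟩
      have e (j : ℤ) : F t j / √(c t) * f j * wt q p i j
          = F t j * f j * wt q p i j * (√(c t))⁻¹ := by ring
      rw [tsum_congr e, tsum_mul_right] at h1
      exact (mul_eq_zero.1 h1).resolve_right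
        (inv_ne_zero (Real.sqrt_pos.2 (hcpos ⟨t, ht⟩)).ne'))
    hh
  refine key.congr_fun fun t => ?_
  have e (j : ℤ) : F t j / √(c t) * h j * wt q p i j
      = backDiff t (wt q p (i + t)) j * h j / √(c t) := by rw [hFw]; ring
  rw [tsum_congr e, tsum_div_const, div_pow, Real.sq_sqrt (hcpos t).le]

/-- Parseval's identity for the standardized polynomials of index `i`. -/
theorem hasSum_stdPolyI_sq {ρ : ℝ} (hρ : 0 < ρ)
    (hexp : Summable fun j : ℤ => Real.exp (ρ * |(j : ℝ)|) * p j) (i : ℕ) {h : ℤ → ℝ}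
    (hh : Summable fun j => h j ^ 2 * wt (quad δ β γ) p i j) :
    HasSum (fun t : {t : ℕ // ∃ j, 0 < wt (quad δ β γ) p (i + t) j} =>
        momentA p (quad δ β γ) i *
          (∑' j, stdPolyI p (quad δ β γ) δ t i j * h j * pmfI p (quad δ β γ) i j) ^ 2)
      (∑' j, h j ^ 2 * wt (quad δ β γ) p i j) := by
  have hmom (N : ℕ) : Summable fun j : ℤ => (1 + |(j : ℝ)|) ^ N * p j := by
    simpa using summable_pow_mul_exp_mul H.nonneg hρ hexp N
  refine (H.hasSum_parseval hρ hexp i hh).congr_fun ?_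
  rintro ⟨t, j₀, hj₀⟩
  have hm := hmom (2 * (i + t))
  have hAi := H.momentA_pos hm hj₀ (i := i) (by omega)
  have hAk := H.momentA_pos hm hj₀ (i := i + t) le_rfl
  have hL := H.leadCoef_pos hm hj₀ (i := i) (t := t) le_rfl
  have e (j : ℤ) : stdPolyI p (quad δ β γ) δ t i j * h j * pmfI p (quad δ β γ) i j
      = backDiff t (wt (quad δ β γ) p (i + t)) j * h j / √(t.factorial * leadCoef δ i t
        * momentA p (quad δ β γ) (i + t) * momentA p (quad δ β γ) i) := by
    rw [mul_right_comm, H.stdPolyI_mul_pmfI hAi]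
    · ring
    · rcases Nat.eq_zero_or_pos t with h | h
      · exact .inr h
      · exact .inl (H.one_sub_pos_of_lt hm hj₀ (by omega))
  simp only
  rw [tsum_congr e, tsum_div_const, div_pow, Real.sq_sqrt (by positivity)]
  field_simp

end OrdSeq

/-! ### From the random variable to its sequence of masses -/

section RandomVariable

variable {Ω : Type*} [MeasurableSpace Ω] {P : Measure Ω} [IsProbabilityMeasure P] {X : Ω → ℤ}
  {μ δ β γ : ℝ}

theorem support_nonempty (hX : Measurable X) : (support P X).Nonempty := by
  by_contra h
  have h0 (j : ℤ) : pmfOf P X j = 0 :=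
    ((pmfOf_nonneg P X j).eq_of_not_lt fun hj => h ⟨j, hj⟩).symm
  have := (hasSum_pmfOf P hX).tsum_eq
  simp [h0] at this

/-- The support is an interval of integers, and `w_k(j) > 0` forces `j, …, j + k` into it. This puts
`k ≤ M` in the form used by the lemmas on weights. -/
theorem IsCO.le_bigM_iff (h : IsCO P X μ δ β γ) (k : ℕ) :
    (k : ℕ∞) ≤ bigM P X ↔ ∃ j, 0 < wt (quad δ β γ) (pmfOf P X) k j := by
  have H := h.ordSeq P
  constructor
  · intro hk
    obtain ⟨a, ha, b, hb, hab⟩ :=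
      exists_add_le_of_le_encard_sub_one hk (support_nonempty h.measurable)
    refine ⟨a, H.wt_pos ha ?_⟩
    rcases hab.lt_or_eq with hlt | heq
    · have h1 := H.flux_pos ha hb (by omega : a ≤ a + k) hlt
      exact (H.nonneg _).lt_of_ne' (right_ne_zero_of_mul h1.ne')
    · rwa [heq]
  · rintro ⟨j, hj⟩
    have hsub : ((Finset.range (k + 1)).image fun r : ℕ => j + (r : ℤ) : Set ℤ) ⊆ support P X := by
      intro x hx
      obtain ⟨r, hr, rfl⟩ := Finset.mem_image.1 (Finset.mem_coe.1 hx)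
      exact ((H.wt_nonneg_and r j).2
        (H.wt_pos_of_le hj (Nat.lt_succ_iff.1 (Finset.mem_range.1 hr)))).2
    have h1 := Set.encard_le_encard hsub
    rw [Set.encard_coe_eq_coe_finsetCard, Finset.card_image_of_injective _
      (fun a b hab => by simpa using hab), Finset.card_range] at h1
    refine ENat.le_sub_of_add_le_left (by simp) ?_
    rw [add_comm]
    exact_mod_cast h1

theorem IsCO.momentA_zero (h : IsCO P X μ δ β γ) : momentA (pmfOf P X) (quad δ β γ) 0 = 1 := by
  rw [momentA_eq (pmfOf_nonneg P X), wt_zero, (hasSum_pmfOf P h.measurable).tsum_eq]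

theorem summable_pow_of_integrable (hX : Measurable X) {N : ℕ}
    (h : Integrable (fun ω => |(X ω : ℝ)| ^ (N + 1)) P) :
    Summable fun j : ℤ => (1 + |(j : ℝ)|) ^ N * pmfOf P X j := by
  have h1 := (integrable_comp_iff P hX fun j => |(j : ℝ)| ^ (N + 1)).1 h
  have h2 := (hasSum_pmfOf P hX).summable
  refine ((h2.add h1).mul_left (2 ^ N)).of_nonneg_of_le
    (fun j => mul_nonneg (by positivity) (pmfOf_nonneg P X j)) fun j => ?_
  have h3 : (1 + |(j : ℝ)|) ^ N ≤ 2 ^ N * (1 + |(j : ℝ)| ^ (N + 1)) :=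
    calc (1 + |(j : ℝ)|) ^ N ≤ (1 + |(j : ℝ)|) ^ (N + 1) :=
          pow_le_pow_right₀ (by linarith [abs_nonneg (j : ℝ)]) N.le_succ
      _ ≤ 2 ^ (N + 1 - 1) * (1 ^ (N + 1) + |(j : ℝ)| ^ (N + 1)) :=
          add_pow_le zero_le_one (abs_nonneg _) _
      _ = _ := by simp
  have := mul_le_mul_of_nonneg_right h3 (pmfOf_nonneg P X j)
  linarith

/-- The parameters that witness membership in `𝒞` may differ from the given ones; a bound on the
masses alone is independent of this choice. -/
theorem InClassC.exists_summable_exp (h : InClassC P X) :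
    ∃ ρ > 0, Summable fun j : ℤ => Real.exp (ρ * |(j : ℝ)|) * pmfOf P X j := by
  obtain ⟨μ, δ, β, γ, hX, hδ | hfin⟩ := h
  · exact (hX.ordSeq P).exists_summable_exp hδ
  · refine ⟨1, one_pos, summable_of_hasFiniteSupport (hfin.subset fun j hj => ?_)⟩
    exact (pmfOf_nonneg P X j).lt_of_ne' (right_ne_zero_of_mul hj)

end RandomVariable

end CumOrd

/-! ### Fourier coefficients of differences and the Parseval identities for `X` -/

theorem mainTheorem4 {Ω : Type*} [MeasurableSpace Ω] (P : Measure Ω) [IsProbabilityMeasure P]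
    (X : Ω → ℤ) (μ δ β γ : ℝ) (hX : CumOrd.IsCO P X μ δ β γ) (g : ℤ → ℝ)
    (p q : ℤ → ℝ) (hp : p = CumOrd.pmfOf P X) (hq : q = CumOrd.quad δ β γ) :
    (∀ k : ℕ, 1 ≤ k → (k : ℕ∞) ≤ CumOrd.bigM P X →
      Integrable (fun ω => |(X ω : ℝ)| ^ (2 * k + 1)) P →
      (∀ i ≤ k, CumOrd.IsPmf (CumOrd.pmfI p q i)) ∧
      ∀ m ≤ k, MemLp (CumOrd.diff m g) 2 (CumOrd.lawOf (CumOrd.pmfI p q m)) →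
        Integrable (fun ω => CumOrd.stdPoly p q δ k (X ω) * g (X ω)) P ∧
        ∀ i ≤ m,
          Integrable (fun j => CumOrd.stdPolyI p q δ (k - i) i j * CumOrd.diff i g j)
            (CumOrd.lawOf (CumOrd.pmfI p q i)) ∧
          ∫ j, CumOrd.stdPolyI p q δ (k - i) i j * CumOrd.diff i g j
              ∂(CumOrd.lawOf (CumOrd.pmfI p q i)) =
            CumOrd.coeffV p q δ k i * ∫ ω, CumOrd.stdPoly p q δ k (X ω) * g (X ω) ∂P) ∧
    (CumOrd.InClassC P X →
      ∀ n : ℕ, 1 ≤ n → (n : ℕ∞) ≤ CumOrd.bigM P X →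
        MemLp (CumOrd.diff n g) 2 (CumOrd.lawOf (CumOrd.pmfI p q n)) →
        (∀ k : ℕ, (k : ℕ∞) ≤ CumOrd.bigM P X →
          Integrable (fun ω => CumOrd.stdPoly p q δ k (X ω) * g (X ω)) P) ∧
        ∀ i ≤ n,
          Integrable (fun ω => CumOrd.ascPow q i (X ω) * (CumOrd.diff i g (X ω)) ^ 2) P ∧
          HasSum
            (fun k : {k : ℕ // i ≤ k ∧ (k : ℕ∞) ≤ CumOrd.bigM P X} =>
              CumOrd.weight δ k i *
                (∫ ω, CumOrd.stdPoly p q δ k (X ω) * g (X ω) ∂P) ^ 2)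
            (∫ ω, CumOrd.ascPow q i (X ω) * (CumOrd.diff i g (X ω)) ^ 2 ∂P)) := by

  have H := hX.ordSeq P
  have hXm := hX.measurable
  rw [← hp] at H
  have hA0 : CumOrd.momentA p q 0 = 1 := by rw [hp, hq]; exact hX.momentA_zero
  have hM := hX.le_bigM_iff
  rw [← hp] at hM
  subst hq
  refine ⟨fun k hk1 hkM hmom => ?_, fun hC n hn1 hnM hg => ?_⟩
  · have hm := CumOrd.summable_pow_of_integrable hXm hmom
    rw [← hp] at hm
    obtain ⟨j₀, hj₀⟩ := (hM k).1 hkM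
    refine ⟨fun i hi => H.isPmf_pmfI hm hj₀ hi, fun m hmk hgm => ?_⟩
    have hg := H.summable_sq_mul_wt hm hj₀ hmk hgm
    have key (i : ℕ) (hi : i ≤ m) := H.integral_stdPolyI_mul hm hj₀ hA0 hmk hg hi
    refine ⟨?_, fun i hi => ?_⟩
    · rw [CumOrd.integrable_comp_iff P hXm
        fun j => CumOrd.stdPoly p (CumOrd.quad δ β γ) δ k j * g j, ← hp]
      have h0 := (key 0 (by omega)).1
      rw [Nat.sub_zero, CumOrd.stdPolyI_zero δ k hA0] at h0
      simpa [CumOrd.pmfI, hA0, CumOrd.ascPow, CumOrd.diff] using h0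
    · rw [CumOrd.integrable_lawOf_iff (H.pmfI_nonneg i), CumOrd.integral_lawOf (H.pmfI_nonneg i),
        CumOrd.integral_comp_eq P hXm fun j => CumOrd.stdPoly p (CumOrd.quad δ β γ) δ k j * g j,
        ← hp]
      exact key i hi
  · obtain ⟨ρ, hρ, hexp⟩ := hC.exists_summable_exp
    rw [← hp] at hexp
    have hmom (N : ℕ) : Summable fun j : ℤ => (1 + |(j : ℝ)|) ^ N * p j := by
      simpa using CumOrd.summable_pow_mul_exp_mul H.nonneg hρ hexp N
    obtain ⟨jn, hjn⟩ := (hM n).1 hnM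
    have hgn := H.summable_sq_mul_wt (hmom _) hjn le_rfl hg
    have hgi (i : ℕ) (hi : i ≤ n) := H.summable_diff_sq (hmom _) hjn hgn hi
    refine ⟨fun k hk => ?_, fun i hi => ?_⟩
    · obtain ⟨j₀, hj₀⟩ := (hM k).1 hk
      rw [CumOrd.integrable_comp_iff P hXm
        fun j => CumOrd.stdPoly p (CumOrd.quad δ β γ) δ k j * g j, ← hp]
      -- Here `m = 0`: the Poincaré inequality has made `g` itself square summable, so `k` may
      -- exceed `n`.
      have h0 := (H.integral_stdPolyI_mul (hmom _) hj₀ hA0 k.zero_le (hgi 0 n.zero_le) le_rfl).1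
      rw [Nat.sub_zero, CumOrd.stdPolyI_zero δ k hA0] at h0
      simpa [CumOrd.pmfI, hA0, CumOrd.ascPow, CumOrd.diff] using h0
    · have e (j : ℤ) : CumOrd.ascPow (CumOrd.quad δ β γ) i j * CumOrd.diff i g j ^ 2 * p j
          = CumOrd.diff i g j ^ 2 * CumOrd.wt (CumOrd.quad δ β γ) p i j := by
        rw [CumOrd.wt]; ring
      rw [CumOrd.integrable_comp_iff P hXm
          fun j => CumOrd.ascPow (CumOrd.quad δ β γ) i j * CumOrd.diff i g j ^ 2,
        CumOrd.integral_comp_eq P hXm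
          fun j => CumOrd.ascPow (CumOrd.quad δ β γ) i j * CumOrd.diff i g j ^ 2, ← hp,
        tsum_congr e]
      refine ⟨(hgi i hi).congr fun j => (e j).symm, ?_⟩
      let E : {k : ℕ // i ≤ k ∧ (k : ℕ∞) ≤ CumOrd.bigM P X} ≃
          {t : ℕ // ∃ j, 0 < CumOrd.wt (CumOrd.quad δ β γ) p (i + t) j} :=
        { toFun := fun k => ⟨k - i, by
            rw [Nat.add_sub_cancel' k.2.1]; exact (hM k).1 k.2.2⟩
          invFun := fun t => ⟨i + t, by omega, (hM _).2 t.2⟩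
          left_inv := fun k => Subtype.ext (Nat.add_sub_cancel' k.2.1)
          right_inv := fun t => Subtype.ext (Nat.add_sub_cancel_left _ _) }
      have hsum := E.hasSum_iff.2 (H.hasSum_stdPolyI_sq hρ hexp i (hgi i hi))
      refine hsum.congr_fun ?_
      rintro ⟨k, hik, hk⟩
      obtain ⟨j₀, hj₀⟩ := (hM k).1 hk
      -- Part (a) with `m = i`, which is available for every `k` from `i` to `M`; squaring it and
      -- multiplying by `E q^{[i]}(X)` leaves exactly `weight δ k i`.
      have h1 := (H.integral_stdPolyI_mul (hmom _) hj₀ hA0 hik (hgi i hi) le_rfl).2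
      have hAi := H.momentA_pos (hmom _) hj₀ hik
      have hw := H.weight_nonneg (hmom _) hj₀ hik
      simp only [Function.comp_apply, E, Equiv.coe_fn_mk]
      rw [h1, CumOrd.integral_comp_eq P hXm
        fun j => CumOrd.stdPoly p (CumOrd.quad δ β γ) δ k j * g j, ← hp, mul_pow,
        CumOrd.coeffV, Real.sq_sqrt (div_nonneg hw hAi.le)]
      field_simp
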